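/- Let $C$ be a convex disc in the plane, that is, a compact convex set with non-empty interior. Two sets \emph{overlap} if their interiors intersect, and \emph{touch} if they intersect but do not overlap. The vectors $v$ for which $v+C$ touches $C$ have pairwise different directions; a finite collection of translates $v_i+C$ touching $C$ is ordered cyclically by the directions of the (distinct) vectors $v_i$ around the origin $o$. Such a collection is called a dual Hadwiger family of $C$ if any two consecutive translates are not disjoint and $o\in\operatorname{conv}\{v_i\}$; it is called a dual strict Hadwiger family of $C$ if any two consecutive translates overlap and $o\in\operatorname{conv}\{v_i\}$. Let $I(C)$ and $I'(C)$ be the minimum number of translates in a dual Hadwiger family and in a dual strict Hadwiger family of $C$, respectively. Then both minima exist, and * $I(C)=6$ and $I'(C)=7$ if $C$ is not a parallelogram; * $I(C)=4$ and $I'(C)=8$ if $C$ is a parallelogram. Moreover, $I(C)$ [respectively $I'(C)$] equals the minimum number of unit vectors, in the norm with unit ball $\tfrac12(C-C)$, that contain $o$ in their convex hull and are such that any two vectors that are consecutive in the cyclic order around $o$ are at distance at most $1$ [respectively less than $1$]. -/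

import Mathlib

open scoped Pointwise

namespace DualHadwiger

/-- The plane. -/
abbrev Plane : Type := EuclideanSpace ℝ (Fin 2)

/-- A convex disc: a compact convex set with non-empty interior in the plane. -/
structure IsConvexDisc (C : Set Plane) : Prop where
  convex : Convex ℝ C
  isCompact : IsCompact C
  interior_nonempty : (interior C).Nonempty

/-- A (non-degenerate) parallelogram: the points `p + s a + t b` with `0 ≤ s, t ≤ 1`, where `a` and
`b` are linearly independent. -/
def IsParallelogram (C : Set Plane) : Prop :=
  ∃ p a b : Plane, LinearIndependent ℝ ![a, b] ∧
    C = {x | ∃ s ∈ Set.Icc (0 : ℝ) 1, ∃ t ∈ Set.Icc (0 : ℝ) 1, x = p + s • a + t • b}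

/-- Two sets overlap if their interiors meet. -/
def Overlap (S T : Set Plane) : Prop := (interior S ∩ interior T).Nonempty

/-- Two sets touch if they meet without overlapping. -/
def Touch (S T : Set Plane) : Prop := (S ∩ T).Nonempty ∧ ¬ Overlap S T

/-- The determinant of two plane vectors, positive exactly if the counterclockwise angle from
`u` to `v` is in `(0, π)`. -/
def cross (u v : Plane) : ℝ := u 0 * v 1 - u 1 * v 0

/-- For vectors in three distinct directions: `u`, `w`, `v` occur in this order when turning
counterclockwise around the origin. The three counterclockwise angles from `u` to `w`, from `w` to
`v` and from `v` to `u` then add up to `2π`, so at least two of them are less than `π`; in the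
opposite orientation they add up to `4π`, and at most one of them is less than `π`. -/
def CCW (u w v : Plane) : Prop :=
  (0 < cross u w ∧ 0 < cross w v) ∨ (0 < cross w v ∧ 0 < cross v u) ∨
    (0 < cross v u ∧ 0 < cross u w)

/-- `v` comes directly after `u` in the counterclockwise cyclic ordering of the vectors of `V`
(used only for sets of non-zero vectors in distinct directions). -/
def Consecutive (V : Finset Plane) (u v : Plane) : Prop :=
  u ∈ V ∧ v ∈ V ∧ u ≠ v ∧ ∀ w ∈ V, ¬ CCW u w v

/-- The translates `v + C`, `v ∈ V`, form a dual Hadwiger family of `C`. -/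
structure IsDualFamily (C : Set Plane) (V : Finset Plane) : Prop where
  touch : ∀ v ∈ V, Touch (v +ᵥ C) C
  consecutive : ∀ u v, Consecutive V u v → ¬ Disjoint (u +ᵥ C) (v +ᵥ C)
  zero_mem : (0 : Plane) ∈ convexHull ℝ (V : Set Plane)

/-- The translates `v + C`, `v ∈ V`, form a dual strict Hadwiger family of `C`. -/
structure IsDualStrictFamily (C : Set Plane) (V : Finset Plane) : Prop where
  touch : ∀ v ∈ V, Touch (v +ᵥ C) C
  consecutive : ∀ u v, Consecutive V u v → Overlap (u +ᵥ C) (v +ᵥ C)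
  zero_mem : (0 : Plane) ∈ convexHull ℝ (V : Set Plane)

/-- The central symmetral `(C - C) / 2`. -/
def symmetral (C : Set Plane) : Set Plane := (1 / 2 : ℝ) • (C - C)

/-- A set of unit vectors, for the norm with unit ball the central symmetral of `C`, that contains
the origin in its convex hull and has all consecutive distances at most 1. -/
structure IsUnitCircuit (C : Set Plane) (V : Finset Plane) : Prop where
  unit : ∀ v ∈ V, gauge (symmetral C) v = 1
  consecutive : ∀ u v, Consecutive V u v → gauge (symmetral C) (u - v) ≤ 1
  zero_mem : (0 : Plane) ∈ convexHull ℝ (V : Set Plane)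

/-- The same with all consecutive distances less than 1. -/
structure IsStrictUnitCircuit (C : Set Plane) (V : Finset Plane) : Prop where
  unit : ∀ v ∈ V, gauge (symmetral C) v = 1
  consecutive : ∀ u v, Consecutive V u v → gauge (symmetral C) (u - v) < 1
  zero_mem : (0 : Plane) ∈ convexHull ℝ (V : Set Plane)

/-- `n` is the minimum size of a finite set of vectors with the property `P`. -/
def IsMinSize (P : Finset Plane → Prop) (n : ℕ) : Prop :=
  IsLeast {m | ∃ V : Finset Plane, P V ∧ V.card = m} n

/-- `n` is the dual Hadwiger number of `C`. -/
def IsDualHadwigerNumber (C : Set Plane) (n : ℕ) : Prop := IsMinSize (IsDualFamily C) n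

/-- `n` is the dual strict Hadwiger number of `C`. -/
def IsDualStrictHadwigerNumber (C : Set Plane) (n : ℕ) : Prop :=
  IsMinSize (IsDualStrictFamily C) n

end DualHadwiger

open scoped Pointwise

namespace DualHadwiger

/-! ### The determinant -/

/-! For the norm with unit ball `(C - C) / 2`, the translates `u + C` and `v + C` meet iff `‖u - v‖
≤ 2`, and overlap iff `‖u - v‖ < 2`. Halving all vectors therefore turns dual families into circuits
of unit vectors with consecutive distances at most `1`, or less than `1`. Moreover `C` is a
parallelogram iff the unit ball is one, which `IsSquare` expresses (`IsNormOf.exists_isSquare`,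
`IsNormOf.isParallelogram`). The rest is geometry of a planar norm.

Lower bounds. As the origin lies in the convex hull, each vector has a successor less than half a
turn ahead. If `k` successive steps never reach half a turn, then `2k + 1` successive vectors are
distinct. In a strict circuit three steps never do: otherwise there would be an inscribed symmetric
hexagon with all sides shorter than `1`, which `half_hexagon` excludes; this gives 7. In a circuit
without a square, two steps never do, which gives 5, and the extremal shapes in `half_hexagon`
cannot be fitted together around a pentagon (`not_pentagon`), which gives 6. For a square, three
vectors would be pairwise too close, and a strict circuit has two vectors on each half-open side,
which gives 4 and 8.

Upper bounds. Every unit vector is a vertex of an inscribed affinely regular hexagon with sides of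
length `1` (`exists_hexagon`); this is a circuit of 6. Keeping one vertex and adding six vectors,
each slightly before the next vertex, makes a strict circuit of 7, provided that no side of the
hexagon can be prolonged clockwise inside the unit ball. If one can, the ball has a side longer than
`1`, and a better hexagon has a vertex on such a side (`exists_good_hexagon_of_side`). The square
has explicit circuits of 4 and 8. -/

@[simp] lemma cross_self (u : Plane) : cross u u = 0 := by simp only [cross]; ring

lemma cross_swap (u v : Plane) : cross v u = -cross u v := by simp only [cross]; ring

@[simp] lemma cross_add_left (u v w : Plane) : cross (u + v) w = cross u w + cross v w := by
  simp only [cross, PiLp.add_apply]; ring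

@[simp] lemma cross_add_right (u v w : Plane) : cross u (v + w) = cross u v + cross u w := by
  simp only [cross, PiLp.add_apply]; ring

@[simp] lemma cross_sub_left (u v w : Plane) : cross (u - v) w = cross u w - cross v w := by
  simp only [cross, PiLp.sub_apply]; ring

@[simp] lemma cross_sub_right (u v w : Plane) : cross u (v - w) = cross u v - cross u w := by
  simp only [cross, PiLp.sub_apply]; ring

@[simp] lemma cross_smul_left (c : ℝ) (u v : Plane) : cross (c • u) v = c * cross u v := by
  simp only [cross, PiLp.smul_apply, smul_eq_mul]; ring

@[simp] lemma cross_smul_right (c : ℝ) (u v : Plane) : cross u (c • v) = c * cross u v := by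
  simp only [cross, PiLp.smul_apply, smul_eq_mul]; ring

@[simp] lemma cross_neg_left (u v : Plane) : cross (-u) v = -cross u v := by
  simp only [cross, PiLp.neg_apply]; ring

@[simp] lemma cross_neg_right (u v : Plane) : cross u (-v) = -cross u v := by
  simp only [cross, PiLp.neg_apply]; ring

@[simp] lemma cross_zero_left (u : Plane) : cross 0 u = 0 := by simp [cross]

@[simp] lemma cross_zero_right (u : Plane) : cross u 0 = 0 := by simp [cross]

lemma cross_smul_eq (u v x : Plane) :
    cross u v • x = cross x v • u + cross u x • v := by
  ext i; fin_cases i <;> simp [cross] <;> ring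

/-- Coordinates with respect to a basis of the plane. -/
lemma eq_coords {u v : Plane} (h : cross u v ≠ 0) (x : Plane) :
    x = (cross x v / cross u v) • u + (cross u x / cross u v) • v := by
  have := cross_smul_eq u v x
  calc x = (cross u v)⁻¹ • (cross u v • x) := by rw [smul_smul, inv_mul_cancel₀ h, one_smul]
    _ = _ := by rw [this, smul_add, smul_smul, smul_smul]; congr 2 <;> ring

lemma exists_coords {u v : Plane} (h : cross u v ≠ 0) (x : Plane) :
    ∃ a b : ℝ, x = a • u + b • v := ⟨_, _, eq_coords h x⟩

lemma exists_smul_of_cross_eq_zero {u x : Plane} (hu : u ≠ 0) (h : cross u x = 0) :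
    ∃ c : ℝ, x = c • u := by
  have hu' : u 0 ≠ 0 ∨ u 1 ≠ 0 := by
    by_contra! hc
    apply hu; ext i; fin_cases i <;> simp [hc]
  simp only [cross] at h
  rcases hu' with h0 | h0
  · refine ⟨x 0 / u 0, ?_⟩
    ext i; fin_cases i <;> simp <;> field_simp; linarith
  · refine ⟨x 1 / u 1, ?_⟩
    ext i; fin_cases i <;> simp <;> field_simp; linarith

/-! ### Planar norms -/

/-- A planar norm, as a continuous definite seminorm. -/
structure IsPlaneNorm (p : Seminorm ℝ Plane) : Prop where
  eq_zero : ∀ x, p x = 0 → x = 0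
  continuous : Continuous p

/-- The unit ball is a parallelogram whose sides have the midpoints `±u`, `±v`. -/
def IsSquare (p : Seminorm ℝ Plane) (u v : Plane) : Prop :=
  p u = 1 ∧ p v = 1 ∧ p (u + v) ≤ 1 ∧ p (u - v) ≤ 1

variable {p : Seminorm ℝ Plane}

lemma map_smul_nonneg {a : ℝ} (ha : 0 ≤ a) (x : Plane) : p (a • x) = a * p x := by
  rw [map_smul_eq_mul, Real.norm_of_nonneg ha]

lemma map_comb_le {a b X Y : ℝ} {x y : Plane} (ha : 0 ≤ a) (hb : 0 ≤ b) (hx : p x ≤ X)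
    (hy : p y ≤ Y) : p (a • x + b • y) ≤ a * X + b * Y := by
  refine (map_add_le_add p _ _).trans ?_
  rw [map_smul_nonneg ha, map_smul_nonneg hb]
  gcongr

lemma ne_zero_of_unit {u : Plane} (h : p u = 1) : u ≠ 0 := by
  rintro rfl; simp at h

lemma eq_or_eq_neg_of_unit {u v : Plane} (hu : p u = 1) (hv : p v = 1) (h : cross u v = 0) :
    v = u ∨ v = -u := by
  obtain ⟨c, rfl⟩ := exists_smul_of_cross_eq_zero (ne_zero_of_unit hu) h
  rw [map_smul_eq_mul, hu, mul_one, Real.norm_eq_abs] at hv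
  rcases (abs_eq one_pos.le).1 hv with rfl | rfl <;> simp

/-- Monotonicity of the distance along the unit circle. -/
lemma map_sub_le_of_mem_cone {u v w : Plane} {s t : ℝ} (hs : 0 ≤ s) (ht : 0 ≤ t)
    (hu : p u = 1) (hv : p v = 1) (hw : p w = 1) (h : v = s • u + t • w) :
    p (u - v) ≤ p (u - w) := by
  have h1 : 1 ≤ s + t := by
    have := map_comb_le (p := p) hs ht hu.le hw.le
    rw [← h, hv] at this; linarith
  have h0 : (0 : ℝ) < s + t := by linarith
  have hr : (0 : ℝ) ≤ (s + t)⁻¹ := by positivity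
  have hr1 : (s + t)⁻¹ ≤ 1 := inv_le_one_of_one_le₀ h1
  have e : (s + t)⁻¹ * s + (s + t)⁻¹ * t = 1 := by field_simp
  -- The point `(s + t)⁻¹ • v` lies on the segment from `u` to `w`. The triangle inequality through
  -- it bounds `u - v` here and `w` in `h3`; in the sum of the two bounds the terms `(s + t)⁻¹`
  -- cancel.
  have h2 : p (u - v) ≤ ((s + t)⁻¹ * t) * p (u - w) + (1 - (s + t)⁻¹) * 1 := by
    have e2 : u - v = ((s + t)⁻¹ * t) • (u - w) + (1 - (s + t)⁻¹) • (-v) := by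
      have : ((s + t)⁻¹) • v = ((s + t)⁻¹ * s) • u + ((s + t)⁻¹ * t) • w := by
        rw [h]; module
      have e' : u = ((s + t)⁻¹ * s) • u + ((s + t)⁻¹ * t) • u := by
        rw [← add_smul, e, one_smul]
      calc u - v = ((s + t)⁻¹ * s) • u + ((s + t)⁻¹ * t) • u - v := by rw [← e']
        _ = ((s + t)⁻¹ * t) • (u - w) - v + (((s + t)⁻¹ * s) • u + ((s + t)⁻¹ * t) • w) := by
          module
        _ = _ := by rw [← this]; module
    calc p (u - v) = _ := congrArg p e2
      _ ≤ _ := map_comb_le (by positivity) (by linarith) le_rfl (by rw [map_neg_eq_map, hv])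
  have h3 : 1 ≤ ((s + t)⁻¹ * s) * p (u - w) + (s + t)⁻¹ * 1 := by
    have e2 : w = ((s + t)⁻¹ * s) • (w - u) + (s + t)⁻¹ • v := by
      have e' : w = ((s + t)⁻¹ * s) • w + ((s + t)⁻¹ * t) • w := by
        rw [← add_smul, e, one_smul]
      conv_lhs => rw [e']
      rw [h]; module
    calc 1 = p w := hw.symm
      _ = _ := congrArg p e2
      _ ≤ _ := map_comb_le (by positivity) hr (by rw [map_sub_rev]) hv.le
  have e3 : ((s + t)⁻¹ * s) * p (u - w) + ((s + t)⁻¹ * t) * p (u - w) = p (u - w) := by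
    rw [← add_mul, e, one_mul]
  linarith

/-- If the unit vector `r` is interior to a segment of the unit ball in the direction `z`, then the
line of the segment supports the unit ball. -/
lemma abs_le_map_of_side {r z : Plane} {e f : ℝ} (he : 0 < e) (hf : 0 < f) (hr : 1 ≤ p r)
    (h1 : p (r - e • z) ≤ 1) (h2 : p (r + f • z) ≤ 1) (x y : ℝ) : |x| ≤ p (x • r + y • z) := by
  -- A point of norm less than `1` on the line would have `r` between itself and one end of the
  -- segment, forcing `p r < 1`.
  have key : ∀ y : ℝ, 1 ≤ p (r + y • z) := by
    intro y
    by_contra! hy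
    have hy0 : y ≠ 0 := by rintro rfl; simp at hy; linarith
    rcases lt_or_gt_of_ne hy0 with h | h
    · have e1 : r = (f / (f - y)) • (r + y • z) + (-y / (f - y)) • (r + f • z) := by
        have : f - y ≠ 0 := by linarith
        match_scalars
        all_goals field_simp
        all_goals ring
      have := map_comb_le (p := p) (a := f / (f - y)) (b := -y / (f - y)) (X := p (r + y • z))
        (by apply div_nonneg <;> linarith) (by apply div_nonneg <;> linarith) le_rfl h2
      rw [← e1] at this
      have h5 : 0 < f / (f - y) := by apply div_pos <;> linarith
      have h6 : f / (f - y) + -y / (f - y) = 1 := by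
        rw [← add_div, ← sub_eq_add_neg, div_self]; linarith
      nlinarith
    · have e1 : r = (e / (e + y)) • (r + y • z) + (y / (e + y)) • (r - e • z) := by
        match_scalars <;> field_simp; ring
      have := map_comb_le (p := p) (a := e / (e + y)) (b := y / (e + y)) (X := p (r + y • z))
        (by positivity) (by positivity) le_rfl h1
      rw [← e1] at this
      have h5 : 0 < e / (e + y) := by positivity
      have h6 : e / (e + y) + y / (e + y) = 1 := by field_simp
      nlinarith
  rcases eq_or_ne x 0 with rfl | hx
  · simp
  · have e1 : x • r + y • z = x • (r + (y / x) • z) := by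
      match_scalars <;> field_simp
    rw [e1, map_smul_eq_mul, Real.norm_eq_abs]
    nlinarith [key (y / x), abs_pos.2 hx]

/-- Both bounds on `x` are triangle inequalities through the segment from `u₀` to `u₀ + u₂`, which
lies in the unit ball: through `u₀ + (1 - l) • u₂` for `x ≤ 1`, through `u₀ + l • u₂` for `x ≥ 1`.
-/
lemma half_hexagon_of_lt {u₀ u₁ u₂ : Plane} (h0 : p u₀ = 1) (h1 : p u₁ = 1) (h2 : p u₂ = 1)
    {x l : ℝ} (hx : 0 < x) (hl : 0 < l) (hl1 : l < 1) (e : u₁ = x • u₀ + l • u₂)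
    (d1 : p (u₁ - u₂) ≤ 1) (d2 : p (u₀ + u₂) ≤ 1) : x = 1 := by
  apply le_antisymm
  · have e1 : (1 + x) • u₀ = (l • u₀ + (1 - l) • (u₀ + u₂)) + (u₁ - u₂) := by rw [e]; module
    have := map_add_le_add p (l • u₀ + (1 - l) • (u₀ + u₂)) (u₁ - u₂)
    rw [← e1, map_smul_nonneg (by linarith), h0] at this
    have := map_comb_le (p := p) hl.le (b := 1 - l) (by linarith) h0.le d2
    linarith
  · by_contra! hc
    have e1 : u₁ = x • ((1 - l) • u₀ + l • (u₀ + u₂)) + ((1 - x) * l) • u₂ := by rw [e]; module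
    have h3 := map_comb_le (p := p) (a := 1 - l) (by linarith) hl.le h0.le d2
    have h4 := map_comb_le (p := p) hx.le (b := (1 - x) * l) (by nlinarith) h3 h2.le
    rw [← e1, h1] at h4
    nlinarith

/-- The extremal triples: half of an inscribed centrally symmetric hexagon with all sides at
most `1`. -/
lemma half_hexagon {u₀ u₁ u₂ : Plane} (h0 : p u₀ = 1) (h1 : p u₁ = 1) (h2 : p u₂ = 1)
    (c01 : 0 < cross u₀ u₁) (c12 : 0 < cross u₁ u₂) (c02 : 0 < cross u₀ u₂)
    (d01 : p (u₀ - u₁) ≤ 1) (d12 : p (u₁ - u₂) ≤ 1) (d02 : p (u₀ + u₂) ≤ 1) :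
    ∃ t : ℝ, 0 < t ∧ t ≤ 1 ∧
      (u₁ = u₀ + t • u₂ ∨ u₁ = u₂ + t • u₀ ∨ u₀ + u₂ = t • u₁) := by
  -- The cases compare the distances of `u₁` and `u₂` from the line of `u₀`.
  rcases lt_trichotomy (cross u₀ u₁) (cross u₀ u₂) with h | h | h
  · have e := eq_coords c02.ne' u₁
    have hl1 : cross u₀ u₁ / cross u₀ u₂ < 1 := by rwa [div_lt_one c02]
    have hl := div_pos c01 c02
    have := half_hexagon_of_lt h0 h1 h2 (div_pos c12 c02) hl hl1 e d12 d02
    rw [this, one_smul] at e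
    exact ⟨_, hl, hl1.le, Or.inl e⟩
  · obtain ⟨t, ht⟩ := exists_smul_of_cross_eq_zero (x := u₁ - u₂) (ne_zero_of_unit h0)
      (by simp [h])
    have e : u₁ = u₂ + t • u₀ := by rw [← ht]; abel
    refine ⟨t, ?_, ?_, Or.inr (Or.inl e)⟩
    · rw [e] at c12
      simp only [cross_add_left, cross_self, cross_smul_left, zero_add] at c12
      exact pos_of_mul_pos_left c12 c02.le
    · rw [ht, map_smul_eq_mul, h0, mul_one] at d12
      exact (le_abs_self t).trans d12
  -- The same hexagon read clockwise: the triple `-u₀`, `u₂`, `u₁` is in the first case.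
  · have e := eq_coords (u := -u₀) (v := u₁) (by simpa using c01.ne') u₂
    have hl1 : cross (-u₀) u₂ / cross (-u₀) u₁ < 1 := by simpa [div_lt_one c01] using h
    have hl : 0 < cross (-u₀) u₂ / cross (-u₀) u₁ := by simpa using div_pos c02 c01
    have hx : 0 < cross u₂ u₁ / cross (-u₀) u₁ := by
      rw [cross_swap u₁ u₂]; simpa using div_pos c12 c01
    have := half_hexagon_of_lt (p := p) (by simpa using h0) h2 h1 hx hl hl1 e
      (by rwa [map_sub_rev]) (by rwa [neg_add_eq_sub, map_sub_rev])
    rw [this, one_smul] at e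
    refine ⟨_, hl, hl1.le, Or.inr (Or.inr ?_)⟩
    conv_lhs => rw [e]
    abel

/-- In each extremal shape some unit vector is a convex combination of a unit vector and a side of
the hexagon, with positive weight on the side, which is shorter than `1`. -/
lemma not_strict_half_hexagon {u₀ u₁ u₂ : Plane} (h0 : p u₀ = 1) (h1 : p u₁ = 1) (h2 : p u₂ = 1)
    (c01 : 0 < cross u₀ u₁) (c12 : 0 < cross u₁ u₂) (c02 : 0 < cross u₀ u₂)
    (d01 : p (u₀ - u₁) < 1) (d12 : p (u₁ - u₂) < 1) (d02 : p (u₀ + u₂) < 1) : False := by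
  obtain ⟨t, ht, ht1, e | e | e⟩ := half_hexagon h0 h1 h2 c01 c12 c02 d01.le d12.le d02.le
  · have e1 : u₁ = (1 - t) • u₀ + t • (u₀ + u₂) := by rw [e]; module
    have := map_comb_le (p := p) (a := 1 - t) (by linarith) ht.le h0.le le_rfl (y := u₀ + u₂)
    rw [← e1, h1] at this; nlinarith
  · have e1 : u₁ = (1 - t) • u₂ + t • (u₀ + u₂) := by rw [e]; module
    have := map_comb_le (p := p) (a := 1 - t) (by linarith) ht.le h2.le le_rfl (y := u₀ + u₂)
    rw [← e1, h1] at this; nlinarith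
  · have e1 : u₀ = (1 - t) • (-u₂) + t • (u₁ - u₂) := by
      have : u₀ = t • u₁ - u₂ := by rw [← e]; abel
      rw [this]; module
    have := map_comb_le (p := p) (a := 1 - t) (by linarith) ht.le
      (by rw [map_neg_eq_map]; exact h2.le : p (-u₂) ≤ 1) le_rfl (y := u₁ - u₂)
    rw [← e1, h0] at this; nlinarith

/-! ### Circuits of unit vectors -/

/-- Unit vectors around the origin with consecutive distances at most `1`. -/
structure IsCircuit (p : Seminorm ℝ Plane) (V : Finset Plane) : Prop where
  unit : ∀ v ∈ V, p v = 1
  consecutive : ∀ u v, Consecutive V u v → p (u - v) ≤ 1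
  zero_mem : (0 : Plane) ∈ convexHull ℝ (V : Set Plane)

/-- Unit vectors around the origin with consecutive distances less than `1`. -/
structure IsStrictCircuit (p : Seminorm ℝ Plane) (V : Finset Plane) : Prop where
  unit : ∀ v ∈ V, p v = 1
  consecutive : ∀ u v, Consecutive V u v → p (u - v) < 1
  zero_mem : (0 : Plane) ∈ convexHull ℝ (V : Set Plane)

lemma IsStrictCircuit.isCircuit {V : Finset Plane} (h : IsStrictCircuit p V) : IsCircuit p V :=
  ⟨h.unit, fun u v huv => (h.consecutive u v huv).le, h.zero_mem⟩

lemma exists_weights {V : Finset Plane} (h : (0 : Plane) ∈ convexHull ℝ (V : Set Plane)) :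
    ∃ l : Plane → ℝ, (∀ v ∈ V, 0 ≤ l v) ∧ ∑ v ∈ V, l v = 1 ∧ ∑ v ∈ V, l v • v = 0 := by
  rw [Finset.convexHull_eq] at h
  obtain ⟨l, h0, h1, h2⟩ := h
  refine ⟨l, h0, h1, ?_⟩
  rw [Finset.centerMass_eq_of_sum_1 _ _ h1] at h2
  simpa using h2

lemma cross_sum_right (u : Plane) (V : Finset Plane) (f : Plane → Plane) :
    cross u (∑ v ∈ V, f v) = ∑ v ∈ V, cross u (f v) := by
  classical
  induction V using Finset.induction_on with
  | empty => simp
  | insert a s ha ih => rw [Finset.sum_insert ha, Finset.sum_insert ha, cross_add_right, ih]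

/-- If `V` lies in a closed half-plane bounded by the line of `d`, a convex combination equal to the
origin only uses vectors on that line. Their coordinates along `d`, which are `cross e v / cross e
d`, balance out without vanishing, so one of them is negative. -/
lemma exists_cross_eq_zero {V : Finset Plane} (h : (0 : Plane) ∈ convexHull ℝ (V : Set Plane))
    {d e : Plane} (hd : cross e d ≠ 0) (hV : (∀ v ∈ V, cross d v ≤ 0) ∨ ∀ v ∈ V, 0 ≤ cross d v)
    (hv0 : ∀ v ∈ V, v ≠ 0) : ∃ v ∈ V, cross d v = 0 ∧ cross e v / cross e d < 0 := by
  obtain ⟨l, h0, h1, h2⟩ := exists_weights h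
  have h3 : ∑ v ∈ V, l v * cross d v = 0 := by
    have := congrArg (cross d) h2
    simpa [cross_sum_right] using this
  have h4 : ∀ v ∈ V, l v * cross d v = 0 := by
    rcases hV with hV | hV
    · exact (Finset.sum_eq_zero_iff_of_nonpos fun v hv =>
        mul_nonpos_of_nonneg_of_nonpos (h0 v hv) (hV v hv)).1 h3
    · exact (Finset.sum_eq_zero_iff_of_nonneg fun v hv => mul_nonneg (h0 v hv) (hV v hv)).1 h3
  have h5 : ∑ v ∈ V, l v * (cross e v / cross e d) = 0 := by
    have := congrArg (cross e) h2
    simp only [cross_sum_right, cross_smul_right, cross_zero_right] at this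
    simp only [← mul_div_assoc, ← Finset.sum_div, this, zero_div]
  obtain ⟨w, hw, hlw⟩ : ∃ w ∈ V, l w ≠ 0 := by
    by_contra! hc
    rw [Finset.sum_congr rfl hc] at h1; simp at h1
  have key : ∀ v ∈ V, l v ≠ 0 → cross d v = 0 ∧ cross e v ≠ 0 := by
    intro v hv hl
    have hdv : cross d v = 0 := (mul_eq_zero.1 (h4 v hv)).resolve_left hl
    refine ⟨hdv, fun hev => hv0 v hv ?_⟩
    have := eq_coords (u := e) (v := d) hd v
    rw [hev, cross_swap d v, hdv] at this
    simpa using this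
  by_contra! hc
  have h6 := (Finset.sum_eq_zero_iff_of_nonneg (s := V)
    (f := fun v => l v * (cross e v / cross e d)) ?_).1 h5 w hw
  · rcases mul_eq_zero.1 h6 with h | h
    · exact hlw h
    · rcases div_eq_zero_iff.1 h with h | h
      · exact (key w hw hlw).2 h
      · exact hd h
  · intro v hv
    by_cases hl : l v = 0
    · simp [hl]
    · exact mul_nonneg (h0 v hv) (hc v hv (key v hv hl).1)

lemma exists_cross_ne_zero {u : Plane} (hu : u ≠ 0) : ∃ e, 0 < cross e u := by
  refine ⟨!₂[u 1, -u 0], ?_⟩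
  have : u 0 ≠ 0 ∨ u 1 ≠ 0 := by
    by_contra! hc
    apply hu; ext i; fin_cases i <;> simp [hc]
  simp only [cross]
  rcases this with h | h
  · have := sq_pos_of_ne_zero h
    simp; nlinarith [sq_nonneg (u 1)]
  · have := sq_pos_of_ne_zero h
    simp; nlinarith [sq_nonneg (u 0)]

/-- Among vectors on one side of a line, one is extreme in the angular order. -/
lemma exists_angular_min {u : Plane} (hu : u ≠ 0) (L : Finset Plane) (hL : L.Nonempty)
    (h : ∀ v ∈ L, 0 < cross u v) : ∃ v ∈ L, ∀ w ∈ L, 0 ≤ cross v w := by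
  obtain ⟨e, he⟩ := exists_cross_ne_zero hu
  -- This quotient acts as the cotangent of the angle from `u`: it decreases as the angle grows.
  obtain ⟨v, hv, hm⟩ := L.exists_max_image (fun v => cross e v / cross u v) hL
  refine ⟨v, hv, fun w hw => ?_⟩
  have h1 := hm w hw
  rw [div_le_div_iff₀ (h w hw) (h v hv)] at h1
  have h2 : cross e u * cross v w = cross e v * cross u w - cross e w * cross u v := by
    simp only [cross]; ring
  have h3 : 0 ≤ cross e u * cross v w := by rw [h2]; linarith
  exact nonneg_of_mul_nonneg_right h3 he

lemma exists_angular_max {d : Plane} (hd : d ≠ 0) (L : Finset Plane) (hL : L.Nonempty)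
    (h : ∀ v ∈ L, 0 < cross v d) : ∃ v ∈ L, ∀ w ∈ L, 0 ≤ cross w v := by
  obtain ⟨e, he⟩ := exists_cross_ne_zero hd
  obtain ⟨v, hv, hm⟩ := L.exists_max_image (fun v => cross e v / cross v d) hL
  refine ⟨v, hv, fun w hw => ?_⟩
  have h1 := hm w hw
  rw [div_le_div_iff₀ (h w hw) (h v hv)] at h1
  have h2 : cross e d * cross w v = cross e v * cross w d - cross e w * cross v d := by
    simp only [cross]; ring
  have h3 : 0 ≤ cross e d * cross w v := by rw [h2]; linarith
  exact nonneg_of_mul_nonneg_right h3 he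

/-- Every vector of a circuit has a successor less than half a turn ahead. -/
lemma IsCircuit.exists_next {V : Finset Plane} (h : IsCircuit p V) {u : Plane} (hu : u ∈ V) :
    ∃ v ∈ V, Consecutive V u v ∧ 0 < cross u v := by
  classical
  have hu0 := ne_zero_of_unit (h.unit u hu)
  by_cases hL : (V.filter fun v => 0 < cross u v).Nonempty
  · obtain ⟨v, hv, hm⟩ := exists_angular_min hu0 _ hL (by simp)
    simp only [Finset.mem_filter] at hv hm
    refine ⟨v, hv.1, ⟨hu, hv.1, ?_, ?_⟩, hv.2⟩
    · rintro rfl; simp at hv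
    · intro w hw hc
      have := cross_swap u v
      have h3 := cross_swap v w
      rcases hc with hc | hc | hc
      · have := hm w ⟨hw, hc.1⟩
        linarith [hc.2]
      · linarith [hc.2, hv.2]
      · linarith [hc.1, hv.2]
  -- With nothing strictly to the left of `u`, the convex hull condition forces `-u ∈ V`; then `-u`
  -- directly follows `u`, at distance `2`.
  · exfalso
    have hle : ∀ v ∈ V, cross u v ≤ 0 := by
      intro v hv
      by_contra! hc
      exact hL ⟨v, by simp [hv, hc]⟩
    obtain ⟨e, he⟩ := exists_cross_ne_zero hu0
    obtain ⟨v, hv, hv1, hv2⟩ := exists_cross_eq_zero h.zero_mem he.ne' (Or.inl hle)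
      fun v hv => ne_zero_of_unit (h.unit v hv)
    rcases eq_or_eq_neg_of_unit (h.unit u hu) (h.unit v hv) hv1 with rfl | rfl
    · rw [div_self he.ne'] at hv2; linarith
    · have h2 : Consecutive V u (-u) := by
        refine ⟨hu, hv, fun hc => hu0 ?_, fun w hw hc => ?_⟩
        · have h2 : (2 : ℝ) • u = 0 := by rw [two_smul]; nth_rewrite 2 [hc]; simp
          simpa using h2
        have h1 := hle w hw
        have h3 := cross_swap u w
        simp only [CCW, cross_neg_right, cross_neg_left, cross_self] at hc
        rcases hc with hc | hc | hc
        · linarith [hc.1]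
        · linarith [hc.2]
        · linarith [hc.1]
      have h3 := h.consecutive _ _ h2
      rw [show u - -u = (2 : ℝ) • u by module, map_smul_nonneg (by norm_num), h.unit u hu] at h3
      linarith

/-- A step beyond `-u` reaches `-u` within the same distance. -/
lemma map_add_le_of_cross {u v w : Plane} (hu : p u = 1) (hv : p v = 1) (hw : p w = 1)
    (huv : 0 ≤ cross u v) (hvw : 0 < cross v w) (huw : cross u w ≤ 0) :
    p (u + v) ≤ p (v - w) := by
  have e := eq_coords hvw.ne' (-u)
  have := map_sub_le_of_mem_cone (p := p) (div_nonneg (by simpa using huw) hvw.le)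
    (div_nonneg (by rw [cross_neg_right, cross_swap]; simpa using huv) hvw.le) hv
    (by simpa using hu) hw e
  rwa [sub_neg_eq_add, add_comm] at this

lemma nonempty_of_zero_mem {V : Finset Plane} (h : (0 : Plane) ∈ convexHull ℝ (V : Set Plane)) :
    V.Nonempty := by
  have := convexHull_nonempty_iff.1 ⟨_, h⟩
  simpa using this

/-- The vectors of a circuit, in cyclic order. -/
lemma IsCircuit.exists_seq {V : Finset Plane} (h : IsCircuit p V) :
    ∃ u : ℕ → Plane, (∀ n, u n ∈ V) ∧ (∀ n, Consecutive V (u n) (u (n + 1))) ∧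
      (∀ n, 0 < cross (u n) (u (n + 1))) ∧ ∀ m n, u m = u n → u (m + 1) = u (n + 1) := by
  classical
  obtain ⟨u₀, hu₀⟩ := nonempty_of_zero_mem h.zero_mem
  -- The sequence iterates a single successor function, so that a repeated vector repeats its
  -- successor; this closes up the pentagon in `IsCircuit.six_le_card`.
  have : ∀ u : Plane, ∃ v, u ∈ V → v ∈ V ∧ Consecutive V u v ∧ 0 < cross u v := by
    intro u
    by_cases hu : u ∈ V
    · obtain ⟨v, hv⟩ := h.exists_next hu
      exact ⟨v, fun _ => hv⟩
    · exact ⟨u, fun h => (hu h).elim⟩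
  choose f hf using this
  have hmem : ∀ n, f^[n] u₀ ∈ V := by
    intro n
    induction n with
    | zero => exact hu₀
    | succ n ih => rw [Function.iterate_succ_apply']; exact (hf _ ih).1
  refine ⟨fun n => f^[n] u₀, hmem, fun n => ?_, fun n => ?_, fun m n hmn => ?_⟩
  · simp only [Function.iterate_succ_apply']; exact (hf _ (hmem n)).2.1
  · simp only [Function.iterate_succ_apply']; exact (hf _ (hmem n)).2.2
  · simp only [Function.iterate_succ_apply'] at hmn ⊢; rw [hmn]

/-- If `k` successive steps never make half a turn, then `2 k + 1` successive vectors are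
distinct. -/
lemma injOn_of_cross_pos {u : ℕ → Plane} {k : ℕ}
    (h : ∀ n j, 1 ≤ j → j ≤ k → 0 < cross (u n) (u (n + j))) :
    Set.InjOn u (Finset.range (2 * k + 1)) := by
  have key : ∀ i j, i < j → j ≤ 2 * k → u i ≠ u j := by
    intro i j hij hj heq
    by_cases hk : j ≤ i + k
    · have := h i (j - i) (by omega) (by omega)
      rw [show i + (j - i) = j by omega, heq, cross_self] at this
      exact lt_irrefl _ this
    -- If `u i = u j`, the intermediate vector `u (j - k)` would have this vector strictly to its
    -- left and strictly to its right.
    · have h1 := h (j - k) k (by omega) le_rfl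
      have h2 := h i (j - k - i) (by omega) (by omega)
      rw [show j - k + k = j by omega, ← heq] at h1
      rw [show i + (j - k - i) = j - k by omega, cross_swap] at h2
      linarith
  intro i hi j hj hij
  simp only [Finset.coe_range, Set.mem_Iio] at hi hj
  by_contra hne
  rcases lt_or_gt_of_ne hne with hlt | hlt
  · exact key i j hlt (by omega) hij
  · exact key j i hlt (by omega) hij.symm

/-! ### Lower bounds for the size of circuits -/

theorem IsStrictCircuit.seven_le_card {V : Finset Plane} (h : IsStrictCircuit p V) :
    7 ≤ V.card := by
  obtain ⟨u, hu, hc, c1, -⟩ := h.isCircuit.exists_seq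
  have unit := fun n => h.unit _ (hu n)
  have d := fun n => h.consecutive _ _ (hc n)
  -- Otherwise the second step passes `-u n`, so `u n + u (n + 1)` and `u n - u (n + 1)` are both
  -- shorter than `1`, although their sum has norm `2`.
  have c2 : ∀ n, 0 < cross (u n) (u (n + 2)) := by
    intro n
    by_contra! hcon
    have h1 := map_add_le_of_cross (unit n) (unit (n + 1)) (unit (n + 2)) (c1 n).le
      (c1 (n + 1)) hcon
    have h2 := map_add_le_add p (u n + u (n + 1)) (u n - u (n + 1))
    rw [show u n + u (n + 1) + (u n - u (n + 1)) = (2 : ℝ) • u n by module,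
      map_smul_nonneg (by norm_num), unit n] at h2
    linarith [d n, d (n + 1)]
  -- Otherwise the third step passes `-u n`, and three successive vectors form half a hexagon with
  -- all sides shorter than `1`.
  have c3 : ∀ n, 0 < cross (u n) (u (n + 3)) := by
    intro n
    by_contra! hcon
    have h1 := map_add_le_of_cross (unit n) (unit (n + 2)) (unit (n + 3)) (c2 n).le
      (c1 (n + 2)) hcon
    exact not_strict_half_hexagon (unit n) (unit (n + 1)) (unit (n + 2)) (c1 n) (c1 (n + 1)) (c2 n)
      (d n) (d (n + 1)) (h1.trans_lt (d (n + 2)))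
  have := Finset.card_le_card_of_injOn (s := Finset.range 7) (t := V) u (fun n _ => hu n)
    (injOn_of_cross_pos (k := 3) (by intro n j h1 h3; interval_cases j <;> simp [c1, c2, c3]))
  simpa using this

/-- Among at most three vectors any two are neighbours, hence at distance at most `1`. Subtracting a
vanishing convex combination from a vector `w` that it uses gives `w = ∑ l v • (w - v)`, where the
term of `w` itself is zero; so `w` would be shorter than `1`. -/
theorem IsCircuit.four_le_card {V : Finset Plane} (h : IsCircuit p V) : 4 ≤ V.card := by
  classical
  by_contra! hlt
  have hccw : ∀ {u w v : Plane}, CCW u w v → w ≠ u ∧ w ≠ v := by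
    intro u w v hc
    constructor <;> rintro rfl <;> simp only [CCW, cross_self] at hc <;>
      rcases hc with hc | hc | hc <;> first
      | linarith [hc.1]
      | linarith [hc.2]
      | (have := cross_swap u w; linarith [hc.1, hc.2])
      | (have := cross_swap v w; linarith [hc.1, hc.2])
  have key : ∀ u ∈ V, ∀ v ∈ V, p (u - v) ≤ 1 := by
    intro u hu v hv
    rcases eq_or_ne u v with rfl | huv
    · simp
    by_cases h1 : Consecutive V u v
    · exact h.consecutive _ _ h1
    by_cases h2 : Consecutive V v u
    · rw [map_sub_rev]; exact h.consecutive _ _ h2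
    exfalso
    simp only [Consecutive, hu, hv, ne_eq, huv, huv.symm, not_false_eq_true, true_and,
      not_forall, not_not] at h1 h2
    obtain ⟨w, hw, hc⟩ := h1
    obtain ⟨x, hx, hc'⟩ := h2
    obtain ⟨a1, a2⟩ := hccw hc
    obtain ⟨b1, b2⟩ := hccw hc'
    have : w = x := by
      by_contra hne
      have : ({u, v, w, x} : Finset Plane).card ≤ V.card :=
        Finset.card_le_card (by simp [Finset.insert_subset_iff, *])
      rw [Finset.card_insert_of_notMem (by simp [huv, a1.symm, b2.symm]),
        Finset.card_insert_of_notMem (by simp [a2.symm, b1.symm]),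
        Finset.card_pair hne] at this
      omega
    subst this
    simp only [CCW] at hc hc'
    have e1 := cross_swap u v
    have e2 := cross_swap u w
    have e3 := cross_swap v w
    rcases hc with ⟨_, _⟩ | ⟨_, _⟩ | ⟨_, _⟩ <;>
      rcases hc' with ⟨_, _⟩ | ⟨_, _⟩ | ⟨_, _⟩ <;> linarith
  obtain ⟨l, h0, h1, h2⟩ := exists_weights h.zero_mem
  obtain ⟨w, hw, hlw⟩ : ∃ w ∈ V, l w ≠ 0 := by
    by_contra! hc
    rw [Finset.sum_congr rfl hc] at h1; simp at h1
  have hlw' : 0 < l w := lt_of_le_of_ne (h0 w hw) hlw.symm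
  have e : w = ∑ v ∈ V, l v • (w - v) := by
    simp only [smul_sub, Finset.sum_sub_distrib, h2, ← Finset.sum_smul, h1]
    simp
  have hlt : p (∑ v ∈ V, l v • (w - v)) < ∑ v ∈ V, l v := by
    refine (Finset.le_sum_of_subadditive p (map_zero p).le (map_add_le_add p) V _).trans_lt ?_
    refine Finset.sum_lt_sum ?_ ⟨w, hw, by simpa using hlw'⟩
    intro v hv
    rw [map_smul_nonneg (h0 v hv)]
    nlinarith [key w hw v hv, h0 v hv]
  rw [← e, h1, h.unit w hw] at hlt
  exact lt_irrefl _ hlt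

/-- Since `b` is interior to the segment from `a` to `a + c`, the linear functional with value `1`
at `a` and `0` at `c` is bounded by the norm. Its value at `a - d` is `1 - α > 1`. -/
lemma not_side_step {a b c d : Plane} {t α γ : ℝ} (hb : p b = 1) (ha : p a ≤ 1)
    (hac : p (a + c) ≤ 1) (ht : 0 < t) (ht1 : t < 1) (e : b = a + t • c)
    (hd : d = α • a + γ • c) (hα : α < 0) (had : p (a - d) ≤ 1) : False := by
  have h := abs_le_map_of_side (p := p) (r := b) (z := c) ht (f := 1 - t) (by linarith) hb.ge
    (by rw [e]; simpa using ha)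
    (by rw [e, show a + t • c + (1 - t) • c = a + c by module]; exact hac)
    (1 - α) (-(1 - α) * t - γ)
  rw [show (1 - α) • b + (-(1 - α) * t - γ) • c = a - d by rw [e, hd]; module] at h
  have := le_abs_self (1 - α)
  linarith

/-- A unit vector is not interior to segments of the unit ball in two directions. -/
lemma cross_eq_zero_of_two_sides {r z z' : Plane} {e f e' f' : ℝ} (he : 0 < e) (hf : 0 < f)
    (he' : 0 < e') (hf' : 0 < f') (hr : p r = 1) (h1 : p (r - e • z) ≤ 1)
    (h2 : p (r + f • z) ≤ 1) (h1' : p (r - e' • z') ≤ 1) (h2' : p (r + f' • z') ≤ 1)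
    (hrz : cross r z ≠ 0) : cross z z' = 0 := by
  obtain ⟨X, Y, hXY⟩ := exists_coords hrz z'
  have h := abs_le_map_of_side he hf hr.ge h1 h2
  have h3 := (h (1 - e' * X) (-e' * Y)).trans_eq (congrArg p (show _ = r - e' • z' by
    rw [hXY]; module))
  have h4 := (h (1 + f' * X) (f' * Y)).trans_eq (congrArg p (show _ = r + f' • z' by
    rw [hXY]; module))
  have h5 := (le_abs_self _).trans (h3.trans h1')
  have h6 := (le_abs_self _).trans (h4.trans h2')
  have h7 : X = 0 := by
    apply le_antisymm
    · by_contra! hc; nlinarith [mul_pos hf' hc]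
    · by_contra! hc; nlinarith [mul_pos_of_neg_of_neg hc (neg_neg_of_pos he')]
  rw [hXY, h7]; simp

lemma not_pentagon (u : Fin 5 → Plane) (unit : ∀ i, p (u i) = 1)
    (c1 : ∀ i, 0 < cross (u i) (u (i + 1))) (c2 : ∀ i, 0 < cross (u i) (u (i + 2)))
    (d : ∀ i, p (u i - u (i + 1)) ≤ 1) : False := by
  have c3 : ∀ i, cross (u i) (u (i + 3)) < 0 := by
    intro i
    have := c2 (i + 3)
    rw [show i + 3 + 2 = i by rw [add_assoc]; exact add_zero i, cross_swap] at this
    linarith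
  have c4 : ∀ i, cross (u i) (u (i + 4)) < 0 := by
    intro i
    have := c1 (i + 4)
    rw [show i + 4 + 1 = i by rw [add_assoc]; exact add_zero i, cross_swap] at this
    linarith
  have c12 : ∀ i, 0 < cross (u (i + 1)) (u (i + 2)) := fun i => by
    have := c1 (i + 1); rwa [add_assoc] at this
  have c23 : ∀ i, 0 < cross (u (i + 2)) (u (i + 3)) := fun i => by
    have := c1 (i + 2); rwa [add_assoc] at this
  have c24 : ∀ i, 0 < cross (u (i + 2)) (u (i + 4)) := fun i => by
    have := c2 (i + 2); rwa [add_assoc] at this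
  have c41 : ∀ i, 0 < cross (u (i + 4)) (u (i + 1)) := fun i => by
    have := c2 (i + 4); rwa [add_assoc] at this
  have d12 : ∀ i, p (u (i + 1) - u (i + 2)) ≤ 1 := fun i => by
    have := d (i + 1); rwa [add_assoc] at this
  have d23 : ∀ i, p (u (i + 2) - u (i + 3)) ≤ 1 := fun i => by
    have := d (i + 2); rwa [add_assoc] at this
  have d34 : ∀ i, p (u (i + 3) - u (i + 4)) ≤ 1 := fun i => by
    have := d (i + 3); rwa [add_assoc] at this
  have d40 : ∀ i, p (u i - u (i + 4)) ≤ 1 := fun i => by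
    have := d (i + 4)
    rwa [show i + 4 + 1 = i by rw [add_assoc]; exact add_zero i, map_sub_rev] at this
  -- The step from `u (i + 2)` to `u (i + 3)` passes `-u i`, so any three successive vectors form
  -- half a hexagon.
  have s : ∀ i, p (u i + u (i + 2)) ≤ 1 := fun i =>
    (map_add_le_of_cross (unit i) (unit (i + 2)) (unit (i + 3)) (c2 i).le (c23 i) (c3 i).le).trans
      (d23 i)
  -- Of the three extremal shapes only the last survives: for `t < 1` the others make the step from
  -- `u i` to `u (i + 4)`, or from `u (i + 2)` to `u (i + 3)`, longer than `1`, and for `t = 1` they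
  -- are instances of the last.
  have hC : ∀ i, ∃ t : ℝ, 0 < t ∧ t ≤ 1 ∧ u i + u (i + 2) = t • u (i + 1) := by
    intro i
    obtain ⟨t, ht, ht1, e | e | e⟩ := half_hexagon (unit i) (unit (i + 1)) (unit (i + 2)) (c1 i)
      (c12 i) (c2 i) (d i) (d12 i) (s i)
    · rcases ht1.lt_or_eq with hlt | rfl
      · exact (not_side_step (unit (i + 1)) (unit i).le (s i) ht hlt e
          (eq_coords (c2 i).ne' (u (i + 4))) (div_neg_of_neg_of_pos (by
            rw [cross_swap]; linarith [c24 i]) (c2 i)) (d40 i)).elim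
      · exact ⟨1, one_pos, le_rfl, by rw [e]; simp⟩
    · rcases ht1.lt_or_eq with hlt | rfl
      · have h20 : cross (u (i + 2)) (u i) < 0 := by rw [cross_swap]; linarith [c2 i]
        exact (not_side_step (unit (i + 1)) (unit (i + 2)).le (by rw [add_comm]; exact s i) ht hlt e
          (eq_coords h20.ne (u (i + 3))) (div_neg_of_pos_of_neg (by
            rw [cross_swap]; linarith [c3 i]) h20) (d23 i)).elim
      · exact ⟨1, one_pos, le_rfl, by rw [e]; simp [add_comm]⟩
    · exact ⟨t, ht, ht1, e⟩
  choose t ht ht1 e using hC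
  have e3 : ∀ i, u (i + 3) + u i = t (i + 3) • u (i + 4) := fun i => by
    have := e (i + 3)
    rwa [show i + 3 + 2 = i by rw [add_assoc]; exact add_zero i, add_assoc] at this
  have e1 : ∀ i, u (i + 1) + u (i + 3) = t (i + 1) • u (i + 2) := fun i => by
    have := e (i + 1)
    rwa [add_assoc, add_assoc] at this
  -- If both factors are less than `1`, then `u i` is interior to segments of the unit ball in the
  -- directions `u (i + 1)` and `u (i + 4)`, which are not parallel.
  have hlt : ∀ i, t i < 1 → t (i + 3) = 1 := by
    intro i hi
    by_contra hne
    have hi' := lt_of_le_of_ne (ht1 (i + 3)) hne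
    have hu2 : u (i + 2) = t i • u (i + 1) - u i := by rw [← e i]; abel
    have hu3 : u (i + 3) = t (i + 3) • u (i + 4) - u i := by rw [← e3 i]; abel
    have := cross_eq_zero_of_two_sides (p := p) (r := u i) (z := u (i + 1)) (z' := u (i + 4))
      one_pos (sub_pos.2 hi) one_pos (sub_pos.2 hi') (unit i) (by simpa using d i)
      (by
        rw [show u i + (1 - t i) • u (i + 1) = u (i + 1) - u (i + 2) by rw [hu2]; module]
        exact d12 i) (by simpa using d40 i)
      (by
        rw [show u i + (1 - t (i + 3)) • u (i + 4) = -(u (i + 3) - u (i + 4)) by rw [hu3]; module,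
          map_neg_eq_map]
        exact d34 i) (c1 i).ne'
    have h41 := c41 i
    rw [cross_swap, this] at h41
    simp at h41
  -- If both factors are `1`, the relations make `u (i + 4)` a multiple of `u (i + 2)`.
  have heq : ∀ i, t i = 1 → t (i + 3) ≠ 1 := by
    intro i hi hi'
    have h1 := e i
    have h3 := e3 i
    rw [hi, one_smul] at h1
    rw [hi', one_smul] at h3
    have h2 := e1 i
    have h4 : u (i + 4) = (t (i + 1) - 1) • u (i + 2) := by
      rw [sub_smul, ← h2, ← h1, ← h3]; module
    have := c24 i
    rw [h4] at this
    simp at this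
  -- The property `t i = 1` would alternate along `i ↦ i + 3`, a cycle of odd length five.
  have key : ∀ i, t i = 1 ↔ t (i + 3) ≠ 1 := fun i =>
    ⟨heq i, fun h => by
      by_contra hne
      exact h (hlt i (lt_of_le_of_ne (ht1 i) hne))⟩
  have k0 := key 0
  have k1 := key 1
  have k2 := key 2
  have k3 := key 3
  have k4 := key 4
  simp only [show (0 : Fin 5) + 3 = 3 from rfl, show (1 : Fin 5) + 3 = 4 from rfl,
    show (2 : Fin 5) + 3 = 0 from rfl, show (3 : Fin 5) + 3 = 1 from rfl,
    show (4 : Fin 5) + 3 = 2 from rfl] at k0 k1 k2 k3 k4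
  tauto

/-- Two steps reaching half a turn would make `u n`, `u (n + 1)` midpoints of the sides of a square.
Hence there are five distinct successive vectors; if they exhaust `V`, the sequence closes after
five steps and `not_pentagon` applies. -/
theorem IsCircuit.six_le_card {V : Finset Plane} (h : IsCircuit p V)
    (hp : ∀ u v, ¬ IsSquare p u v) : 6 ≤ V.card := by
  classical
  obtain ⟨u, hu, hc, c1, hs⟩ := h.exists_seq
  have unit := fun n => h.unit _ (hu n)
  have d := fun n => h.consecutive _ _ (hc n)
  have c2 : ∀ n, 0 < cross (u n) (u (n + 2)) := fun n => by
    by_contra! hcon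
    have h1 := map_add_le_of_cross (unit n) (unit (n + 1)) (unit (n + 2)) (c1 n).le
      (c1 (n + 1)) hcon
    exact hp _ _ ⟨unit n, unit (n + 1), h1.trans (d (n + 1)), d n⟩
  have hinj := injOn_of_cross_pos (u := u) (k := 2)
    (by intro n j h1 h3; interval_cases j <;> simp [c1, c2])
  by_contra! hlt
  have him : (Finset.range 5).image u = V := by
    apply Finset.eq_of_subset_of_card_le
    · intro x hx
      obtain ⟨n, -, rfl⟩ := Finset.mem_image.1 hx
      exact hu n
    · rw [Finset.card_image_of_injOn hinj]; simp; omega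
  have h5 : u 5 = u 0 := by
    obtain ⟨n, hn, hn5⟩ := Finset.mem_image.1 (him.symm ▸ hu 5)
    rw [Finset.mem_range] at hn
    have a1 := c1 4
    have a2 := c2 3
    have b1 := c1 2
    have b2 := c2 1
    norm_num at a1 a2 b1 b2
    rw [cross_swap] at b1 b2
    interval_cases n
    · exact hn5.symm
    · rw [← hn5] at a2; linarith
    · rw [← hn5] at a2; linarith
    · rw [← hn5] at a2; simp at a2
    · rw [← hn5] at a1; simp at a1
  have h6 : u 6 = u 1 := hs 5 0 h5
  have c14 := c1 4
  have c23 := c2 3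
  have c24 := c2 4
  have d4 := d 4
  norm_num [h5, h6] at c14 c23 c24 d4
  refine not_pentagon (p := p) (fun i : Fin 5 => u i) (fun i => unit _) ?_ ?_ ?_
  · intro i; fin_cases i <;> first | exact c1 _ | exact c14
  · intro i; fin_cases i <;> first | exact c2 _ | exact c23 | exact c24
  · intro i; fin_cases i <;> first | exact d _ | exact d4

/-! ### Square norms -/

lemma IsSquare.cross_ne_zero {a b : Plane} (h : IsSquare p a b) : cross a b ≠ 0 := by
  obtain ⟨ha, hb, h1, h2⟩ := h
  intro hc
  rcases eq_or_eq_neg_of_unit ha hb hc with rfl | rfl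
  · rw [← two_smul ℝ b, map_smul_nonneg (by norm_num), ha] at h1; linarith
  · rw [sub_neg_eq_add, ← two_smul ℝ a, map_smul_nonneg (by norm_num), ha] at h2; linarith

lemma IsSquare.symm {a b : Plane} (h : IsSquare p a b) : IsSquare p b a :=
  ⟨h.2.1, h.1, by rw [add_comm]; exact h.2.2.1, by rw [map_sub_rev]; exact h.2.2.2⟩

lemma IsSquare.rotate {a b : Plane} (h : IsSquare p a b) : IsSquare p b (-a) :=
  ⟨h.2.1, by simpa using h.1, by
    rw [← sub_eq_add_neg, map_sub_rev]; exact h.2.2.2, by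
    rw [sub_neg_eq_add, add_comm]; exact h.2.2.1⟩

lemma IsSquare.abs_le {a b : Plane} (h : IsSquare p a b) (x y : ℝ) : |x| ≤ p (x • a + y • b) :=
  abs_le_map_of_side one_pos one_pos h.1.ge (by simpa using h.2.2.2) (by simpa using h.2.2.1) x y

lemma IsSquare.map_eq {a b : Plane} (h : IsSquare p a b) (x y : ℝ) :
    p (x • a + y • b) = max |x| |y| := by
  have key : ∀ {a b : Plane}, IsSquare p a b → ∀ x y : ℝ, |y| ≤ |x| → p (x • a + y • b) ≤ |x| := by
    intro a b h x y hxy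
    rcases eq_or_ne x 0 with rfl | hx
    · have : y = 0 := by simpa using hxy
      simp [this]
    have hx' := abs_pos.2 hx
    have hq : |y / x| ≤ 1 := by rw [abs_div]; exact (div_le_one hx').2 hxy
    rw [_root_.abs_le] at hq
    have e : x • a + y • b = x • (((1 + y / x) / 2) • (a + b) + ((1 - y / x) / 2) • (a - b)) := by
      match_scalars <;> field_simp <;> ring
    rw [e, map_smul_eq_mul, Real.norm_eq_abs]
    have := map_comb_le (p := p) (a := (1 + y / x) / 2) (b := (1 - y / x) / 2) (by linarith)
      (by linarith) h.2.2.1 h.2.2.2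
    nlinarith
  apply le_antisymm
  · rcases le_total |y| |x| with hle | hle
    · exact (key h x y hle).trans (le_max_left _ _)
    · rw [add_comm]; exact (key h.symm y x hle).trans (le_max_right _ _)
  · refine max_le (h.abs_le x y) ?_
    rw [add_comm]; exact h.symm.abs_le y x

/-- A strict circuit meets each side of a square, without its final vertex, at least twice. -/
lemma IsStrictCircuit.two_le_card_side {V : Finset Plane} (h : IsStrictCircuit p V) {a b : Plane}
    (hs : IsSquare p a b) (hab : 0 < cross a b) (S : Finset Plane)
    (hS : ∀ y : ℝ, -1 ≤ y → y < 1 → a + y • b ∈ V → a + y • b ∈ S) : 2 ≤ S.card := by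
  classical
  have hd0 : a - b ≠ 0 := by
    intro h0
    have := congrArg (cross a) h0
    simp at this; linarith
  obtain ⟨e, he⟩ := exists_cross_ne_zero hd0
  have hne : (V.filter fun v => 0 < cross v (a - b)).Nonempty := by
    by_contra hemp
    have hle : ∀ v ∈ V, 0 ≤ cross (a - b) v := by
      intro v hv
      by_contra! hc
      refine hemp ⟨v, Finset.mem_filter.2 ⟨hv, ?_⟩⟩
      rw [cross_swap]; linarith
    obtain ⟨v, hv, hv1, hv2⟩ := exists_cross_eq_zero h.zero_mem he.ne' (Or.inr hle)
      fun v hv => ne_zero_of_unit (h.unit v hv)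
    obtain ⟨c, rfl⟩ := exists_smul_of_cross_eq_zero (u := a - b) hd0 hv1
    rw [cross_smul_right, mul_div_assoc, div_self he.ne', mul_one] at hv2
    obtain ⟨w, hw, -, hcw⟩ := h.isCircuit.exists_next hv
    rw [cross_smul_left] at hcw
    nlinarith [hle w hw]
  -- Here `u` is the last vector before the initial vertex `a - b`. The next two, `v` and `w`, are
  -- the vectors sought: steps shorter than `1` in both coordinates put `u` on the preceding side,
  -- at height `-1`, so `v` stays below height `0` and `w` below height `1`.
  obtain ⟨u, hu, hm⟩ := exists_angular_max hd0 _ hne fun v hv => (Finset.mem_filter.1 hv).2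
  simp only [Finset.mem_filter] at hu hm
  obtain ⟨v, hv, cv, huv⟩ := h.isCircuit.exists_next hu.1
  obtain ⟨w, hw, cw, hvw⟩ := h.isCircuit.exists_next hv
  have hvd : cross v (a - b) ≤ 0 := by
    by_contra! hc
    have := hm v ⟨hv, hc⟩
    rw [cross_swap] at this; linarith
  have hud := hu.2
  have duv := h.consecutive _ _ cv
  have dvw := h.consecutive _ _ cw
  have uu := h.unit u hu.1
  have uv := h.unit v hv
  have uw := h.unit w hw
  obtain ⟨x, y, rfl⟩ := exists_coords hab.ne' u
  obtain ⟨x', y', rfl⟩ := exists_coords hab.ne' v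
  obtain ⟨x₂, y₂, rfl⟩ := exists_coords hab.ne' w
  have hba := cross_swap a b
  rw [show x • a + y • b - (x' • a + y' • b) = (x - x') • a + (y - y') • b by module, hs.map_eq,
    max_lt_iff, abs_lt, abs_lt] at duv
  rw [show x' • a + y' • b - (x₂ • a + y₂ • b) = (x' - x₂) • a + (y' - y₂) • b by module,
    hs.map_eq, max_lt_iff, abs_lt, abs_lt] at dvw
  rw [hs.map_eq] at uu uv uw
  simp only [cross_add_left, cross_smul_left, cross_sub_right, cross_add_right, cross_smul_right,
    cross_self, hba] at hvd hud huv hvw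
  have hud' : x + y < 0 := by
    by_contra! hc; nlinarith
  have hvd' : 0 ≤ x' + y' := by
    by_contra! hc; nlinarith
  have huv' : 0 < x * y' - y * x' := by
    by_contra! hc; nlinarith
  have hvw' : 0 < x' * y₂ - y' * x₂ := by
    by_contra! hc; nlinarith
  have bound : ∀ {s t : ℝ}, max |s| |t| = 1 →
      (-1 ≤ s ∧ s ≤ 1) ∧ (-1 ≤ t ∧ t ≤ 1) ∧ ((s = 1 ∨ s = -1) ∨ (t = 1 ∨ t = -1)) := by
    intro s t hst
    refine ⟨abs_le.1 (hst ▸ le_max_left _ _), abs_le.1 (hst ▸ le_max_right _ _), ?_⟩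
    rcases max_choice |s| |t| with h | h <;> rw [hst] at h
    · exact Or.inl ((abs_eq one_pos.le).1 h.symm)
    · exact Or.inr ((abs_eq one_pos.le).1 h.symm)
  obtain ⟨bx, bY, hxy⟩ := bound uu
  obtain ⟨bx', bY', hxy'⟩ := bound uv
  obtain ⟨bx₂, bY₂, hxy₂⟩ := bound uw
  have hy : y = -1 := by
    rcases hxy with (rfl | rfl) | (rfl | rfl)
    · linarith
    · by_contra hne
      have hy' : y' = 1 := by
        rcases hxy' with (rfl | rfl) | (rfl | rfl) <;> linarith
      subst hy'
      nlinarith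
    · linarith
    · rfl
  subst hy
  have hx' : x' = 1 := by
    rcases hxy' with (rfl | rfl) | (rfl | rfl) <;> linarith
  subst hx'
  have hx₂ : x₂ = 1 := by
    rcases hxy₂ with (rfl | rfl) | (rfl | rfl)
    · rfl
    · linarith
    · linarith
    · nlinarith
  subst hx₂
  rw [one_smul] at hv hw
  have hne : a + y' • b ≠ a + y₂ • b := by
    intro heq
    have := congrArg (cross a) heq
    simp only [cross_add_right, cross_self, cross_smul_right, zero_add] at this
    have := mul_right_cancel₀ hab.ne' this
    linarith
  rw [← Finset.card_pair hne]
  apply Finset.card_le_card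
  rw [Finset.insert_subset_iff, Finset.singleton_subset_iff]
  exact ⟨hS _ (by linarith) (by linarith) hv, hS _ (by linarith) (by linarith) hw⟩

/-- The four half-open sides, obtained from one another by `IsSquare.rotate`, are pairwise disjoint
and contain two vectors each. -/
theorem IsStrictCircuit.eight_le_card {V : Finset Plane} (h : IsStrictCircuit p V) {a b : Plane}
    (hs : IsSquare p a b) : 8 ≤ V.card := by
  classical
  wlog hab : 0 < cross a b generalizing a b
  · refine this hs.symm ?_
    rw [cross_swap]
    have := lt_of_le_of_ne (not_lt.1 hab) hs.cross_ne_zero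
    linarith
  let X : Plane → ℝ := fun v => cross v b / cross a b
  let Y : Plane → ℝ := fun v => cross a v / cross a b
  have hX : ∀ x y : ℝ, X (x • a + y • b) = x := fun x y => by simp [X, hab.ne']
  have hY : ∀ x y : ℝ, Y (x • a + y • b) = y := fun x y => by simp [Y, hab.ne']
  have hba : 0 < cross b (-a) := by rw [cross_neg_right, ← cross_swap]; exact hab
  have h1 := h.two_le_card_side hs hab (V.filter fun v => X v = 1 ∧ -1 ≤ Y v ∧ Y v < 1) (by
    intro y h1 h2 hv
    rw [Finset.mem_filter]
    refine ⟨hv, ?_⟩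
    rw [show a + y • b = (1 : ℝ) • a + y • b by module, hX, hY]
    exact ⟨rfl, h1, h2⟩)
  have h2 := h.two_le_card_side hs.rotate hba (V.filter fun v => Y v = 1 ∧ -1 < X v ∧ X v ≤ 1) (by
    intro y h1 h2 hv
    rw [Finset.mem_filter]
    refine ⟨hv, ?_⟩
    rw [show b + y • -a = (-y) • a + (1 : ℝ) • b by module, hX, hY]
    exact ⟨rfl, by linarith, by linarith⟩)
  have h3 := h.two_le_card_side hs.rotate.rotate (by simpa using hab)
    (V.filter fun v => X v = -1 ∧ -1 < Y v ∧ Y v ≤ 1) (by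
    intro y h1 h2 hv
    rw [Finset.mem_filter]
    refine ⟨hv, ?_⟩
    rw [show -a + y • -b = (-1 : ℝ) • a + (-y) • b by module, hX, hY]
    exact ⟨rfl, by linarith, by linarith⟩)
  have h4 := h.two_le_card_side hs.rotate.rotate.rotate (by simpa using hba)
    (V.filter fun v => Y v = -1 ∧ -1 ≤ X v ∧ X v < 1) (by
    intro y h1 h2 hv
    rw [Finset.mem_filter]
    refine ⟨hv, ?_⟩
    rw [show -b + y • - -a = y • a + (-1 : ℝ) • b by module, hX, hY]
    exact ⟨rfl, by linarith, by linarith⟩)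
  have d12 : Disjoint (V.filter fun v => X v = 1 ∧ -1 ≤ Y v ∧ Y v < 1)
      (V.filter fun v => Y v = 1 ∧ -1 < X v ∧ X v ≤ 1) :=
    Finset.disjoint_filter.2 fun v _ h h' => by linarith [h.2.2, h'.1]
  have d34 : Disjoint (V.filter fun v => X v = -1 ∧ -1 < Y v ∧ Y v ≤ 1)
      (V.filter fun v => Y v = -1 ∧ -1 ≤ X v ∧ X v < 1) :=
    Finset.disjoint_filter.2 fun v _ h h' => by linarith [h.2.1, h'.1]
  have d : Disjoint ((V.filter fun v => X v = 1 ∧ -1 ≤ Y v ∧ Y v < 1) ∪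
      (V.filter fun v => Y v = 1 ∧ -1 < X v ∧ X v ≤ 1))
      ((V.filter fun v => X v = -1 ∧ -1 < Y v ∧ Y v ≤ 1) ∪
      (V.filter fun v => Y v = -1 ∧ -1 ≤ X v ∧ X v < 1)) := by
    rw [Finset.disjoint_union_left, Finset.disjoint_union_right, Finset.disjoint_union_right]
    refine ⟨⟨?_, ?_⟩, ?_, ?_⟩ <;> refine Finset.disjoint_filter.2 fun v _ h h' => ?_
    · linarith [h.1, h'.1]
    · linarith [h.1, h'.2.2]
    · linarith [h.2.1, h'.1]
    · linarith [h.1, h'.1]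
  have hsub : ((V.filter fun v => X v = 1 ∧ -1 ≤ Y v ∧ Y v < 1) ∪
      (V.filter fun v => Y v = 1 ∧ -1 < X v ∧ X v ≤ 1)) ∪
      ((V.filter fun v => X v = -1 ∧ -1 < Y v ∧ Y v ≤ 1) ∪
      (V.filter fun v => Y v = -1 ∧ -1 ≤ X v ∧ X v < 1)) ⊆ V := by
    simp [Finset.union_subset_iff, Finset.filter_subset]
  have := Finset.card_le_card hsub
  rw [Finset.card_union_of_disjoint d, Finset.card_union_of_disjoint d12,
    Finset.card_union_of_disjoint d34] at this
  omega

/-! ### Constructions -/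

open Classical in
/-- The vectors with given coordinates. -/
noncomputable def coordVectors {n : ℕ} (a b : Plane) (X Y : Fin n → ℝ) : Finset Plane :=
  Finset.univ.image fun i => X i • a + Y i • b

lemma mem_coordVectors {n : ℕ} {a b : Plane} {X Y : Fin n → ℝ} {x : Plane} :
    x ∈ coordVectors a b X Y ↔ ∃ i, X i • a + Y i • b = x := by
  simp [coordVectors]

lemma card_coordVectors_le {n : ℕ} (a b : Plane) (X Y : Fin n → ℝ) :
    (coordVectors a b X Y).card ≤ n := by
  classical
  exact Finset.card_image_le.trans (by simp)

lemma cross_coords (a b : Plane) (x y x' y' : ℝ) :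
    cross (x • a + y • b) (x' • a + y' • b) = (x * y' - y * x') * cross a b := by
  simp only [cross_add_left, cross_add_right, cross_smul_left, cross_smul_right, cross_self,
    cross_swap a b]
  ring

/-- The successor relation of vectors listed in cyclic order. -/
lemma exists_of_consecutive {n : ℕ} [NeZero n] {a b : Plane} (hab : 0 < cross a b)
    {X Y : Fin n → ℝ} (c : ∀ i, 0 < X i * Y (i + 1) - Y i * X (i + 1))
    (s : ∀ i j, j ≠ i → j ≠ i + 1 →
      0 < X (i + 1) * Y j - Y (i + 1) * X j ∨ 0 < X j * Y i - Y j * X i)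
    {x y : Plane} (h : Consecutive (coordVectors a b X Y) x y) :
    ∃ i, x = X i • a + Y i • b ∧ y = X (i + 1) • a + Y (i + 1) • b := by
  obtain ⟨hx, hy, hne, hw⟩ := h
  obtain ⟨i, rfl⟩ := mem_coordVectors.1 hx
  obtain ⟨j, rfl⟩ := mem_coordVectors.1 hy
  refine ⟨i, rfl, ?_⟩
  by_cases hj : j = i + 1
  · rw [hj]
  exfalso
  -- The vector of index `i + 1` separates the supposed neighbours: `c i` and either alternative of
  -- `s i j` provide two of the determinants in `CCW`.
  refine hw _ (mem_coordVectors.2 ⟨i + 1, rfl⟩) ?_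
  simp only [CCW, cross_coords]
  have h1 := mul_pos (c i) hab
  rcases s i j (fun h => hne (by rw [h])) hj with h | h
  · exact Or.inl ⟨h1, mul_pos h hab⟩
  · exact Or.inr (Or.inr ⟨mul_pos h hab, h1⟩)

lemma zero_mem_of_neg_mem {V : Finset Plane} {x : Plane} (hx : x ∈ V) (hx' : -x ∈ V) :
    (0 : Plane) ∈ convexHull ℝ (V : Set Plane) := by
  have := convex_convexHull ℝ (V : Set Plane) (subset_convexHull ℝ _ hx)
    (subset_convexHull ℝ _ hx') (a := 1 / 2) (b := 1 / 2) (by norm_num) (by norm_num) (by norm_num)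
  simpa using this

/-- The weights come from the identity `cross y z • x + cross z x • y + cross x y • z = 0`. -/
lemma zero_mem_of_cross_pos {V : Finset Plane} {x y z : Plane} (hx : x ∈ V) (hy : y ∈ V)
    (hz : z ∈ V) (hxy : 0 < cross x y) (hyz : 0 < cross y z) (hzx : 0 < cross z x) :
    (0 : Plane) ∈ convexHull ℝ (V : Set Plane) := by
  have h := (convex_convexHull ℝ (V : Set Plane)).sum_mem (t := Finset.univ)
    (w := ![cross y z / (cross y z + cross z x + cross x y),
      cross z x / (cross y z + cross z x + cross x y),
      cross x y / (cross y z + cross z x + cross x y)]) (z := ![x, y, z])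
    (by intro i _; fin_cases i <;> simp <;> positivity)
    (by simp [Fin.sum_univ_succ]; field_simp; ring)
    (by
      intro i _
      fin_cases i
      · exact subset_convexHull ℝ _ hx
      · exact subset_convexHull ℝ _ hy
      · exact subset_convexHull ℝ _ hz)
  convert h using 1
  have e := cross_smul_eq y z x
  simp only [Fin.sum_univ_succ, Matrix.cons_val_zero, Matrix.cons_val_succ,
    Finset.univ_eq_empty, Finset.sum_empty, add_zero, div_eq_inv_mul, mul_smul, e]
  rw [cross_swap z x, cross_swap x y]
  module

/-- Every unit vector spans an inscribed affinely regular hexagon. -/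
lemma exists_hexagon (hp : IsPlaneNorm p) {u : Plane} (hu : p u = 1) :
    ∃ v, p v = 1 ∧ p (v - u) = 1 ∧ 0 < cross u v := by
  obtain ⟨e, he⟩ := exists_cross_ne_zero (ne_zero_of_unit hu)
  -- A curve from `u` to `-u`; the term in `-e` keeps it off the origin and, in between, to the left
  -- of `u`. After normalisation its distance from `u` goes from `0` to `2`, hence takes the value
  -- `1`.
  let c : ℝ → Plane := fun t => (1 - 2 * t) • u + (t * (1 - t)) • (-e)
  have hcr : ∀ t, cross u (c t) = t * (1 - t) * cross e u := by
    intro t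
    simp only [c, cross_add_right, cross_smul_right, cross_self, cross_neg_right, cross_swap e u]
    ring
  have hpc : ∀ t ∈ Set.Icc (0 : ℝ) 1, p (c t) ≠ 0 := by
    intro t ht h0
    have h1 := hp.eq_zero _ h0
    have h2 := hcr t
    rw [h1, cross_zero_right] at h2
    have h3 : t * (1 - t) = 0 := (mul_eq_zero.1 h2.symm).resolve_right he.ne'
    rcases mul_eq_zero.1 h3 with h | h
    · rw [h] at h1; simp only [c] at h1; exact ne_zero_of_unit hu (by simpa using h1)
    · rw [show t = 1 by linarith] at h1; simp only [c] at h1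
      norm_num at h1
      exact ne_zero_of_unit hu h1
  have hcc : Continuous c := by fun_prop
  have hcont : ContinuousOn (fun t => p ((p (c t))⁻¹ • c t - u)) (Set.Icc 0 1) := by
    refine hp.continuous.comp_continuousOn ?_
    have hi : ContinuousOn (fun t => (p (c t))⁻¹) (Set.Icc 0 1) :=
      (hp.continuous.comp hcc).continuousOn.inv₀ hpc
    exact (hi.smul hcc.continuousOn).sub continuousOn_const
  have h0 : p ((p (c 0))⁻¹ • c 0 - u) = 0 := by simp [c, hu]
  have h1 : p ((p (c 1))⁻¹ • c 1 - u) = 2 := by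
    have e1 : c 1 = -u := by simp only [c]; norm_num
    rw [e1, map_neg_eq_map, hu, show (1 : ℝ)⁻¹ • -u - u = -((2 : ℝ) • u) by module, map_neg_eq_map,
      map_smul_nonneg (by norm_num), hu, mul_one]
  obtain ⟨t, ht, ht1⟩ := intermediate_value_Icc zero_le_one hcont
    (show (1 : ℝ) ∈ Set.Icc _ _ by rw [h0, h1]; constructor <;> norm_num)
  have hpos : 0 < p (c t) := lt_of_le_of_ne (apply_nonneg p _) (hpc t ht).symm
  refine ⟨_, ?_, ht1, ?_⟩
  · rw [map_smul_nonneg (by positivity), inv_mul_cancel₀ hpos.ne']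
  · have ht0 : t ≠ 0 := by rintro rfl; simp only [h0] at ht1; norm_num at ht1
    have ht2 : t ≠ 1 := by rintro rfl; simp only [h1] at ht1; norm_num at ht1
    rw [cross_smul_right, hcr]
    have h3 : 0 < t := lt_of_le_of_ne ht.1 ht0.symm
    have h4 : 0 < 1 - t := sub_pos.2 (lt_of_le_of_ne ht.2 ht2)
    positivity

lemma exists_unit (hp : IsPlaneNorm p) : ∃ u, p u = 1 := by
  let e : Plane := !₂[1, 0]
  have he : e ≠ 0 := by
    intro h
    have := congrArg (fun x : Plane => x 0) h
    simp [e] at this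
  have hpos : 0 < p e := lt_of_le_of_ne (apply_nonneg p _) fun h => he (hp.eq_zero _ h.symm)
  exact ⟨(p e)⁻¹ • e, by rw [map_smul_nonneg (by positivity), inv_mul_cancel₀ hpos.ne']⟩

theorem exists_circuit_six (hp : IsPlaneNorm p) : ∃ V, IsCircuit p V ∧ V.card ≤ 6 := by
  obtain ⟨u, hu⟩ := exists_unit hp
  obtain ⟨v, hv, hvu, huv⟩ := exists_hexagon hp hu
  have huv' : p (u - v) = 1 := by rw [map_sub_rev]; exact hvu
  -- The hexagon `u`, `v`, `v - u` and their negatives: each difference of neighbours is again one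
  -- of these six. Integer coordinates make the cyclic order decidable.
  let X : Fin 6 → ℤ := ![1, 0, -1, -1, 0, 1]
  let Y : Fin 6 → ℤ := ![0, 1, 1, 0, -1, -1]
  refine ⟨coordVectors u v (fun i => (X i : ℝ)) (fun i => (Y i : ℝ)), ⟨?_, ?_, ?_⟩,
    card_coordVectors_le _ _ _ _⟩
  · intro x hx
    obtain ⟨i, rfl⟩ := mem_coordVectors.1 hx
    fin_cases i <;> simp [X, Y, hu, hv, ← sub_eq_add_neg, huv', neg_add_eq_sub, hvu]
  · intro x y hxy
    obtain ⟨i, rfl, rfl⟩ := exists_of_consecutive huv (fun i => by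
      have : 0 < X i * Y (i + 1) - Y i * X (i + 1) := by revert i; decide
      exact_mod_cast this) (fun i j hi hj => by
      have : 0 < X (i + 1) * Y j - Y (i + 1) * X j ∨ 0 < X j * Y i - Y j * X i := by
        revert i j; decide
      exact_mod_cast this) hxy
    have key : ∀ i : Fin 6, (X i - X (i + 1), Y i - Y (i + 1)) ∈
        ({(1, 0), (0, 1), (-1, 1), (-1, 0), (0, -1), (1, -1)} : Finset (ℤ × ℤ)) := by decide
    have hk := key i
    simp only [Finset.mem_insert, Finset.mem_singleton, Prod.mk.injEq] at hk
    rw [show (X i : ℝ) • u + (Y i : ℝ) • v - ((X (i + 1) : ℝ) • u + (Y (i + 1) : ℝ) • v) =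
      ((X i - X (i + 1) : ℤ) : ℝ) • u + ((Y i - Y (i + 1) : ℤ) : ℝ) • v by push_cast; module]
    rcases hk with ⟨h1, h2⟩ | ⟨h1, h2⟩ | ⟨h1, h2⟩ | ⟨h1, h2⟩ | ⟨h1, h2⟩ | ⟨h1, h2⟩ <;>
      rw [h1, h2] <;> simp [hu, hv, ← sub_eq_add_neg, huv', neg_add_eq_sub, hvu]
  · exact zero_mem_of_neg_mem (x := u) (mem_coordVectors.2 ⟨0, by simp [X, Y]⟩)
      (mem_coordVectors.2 ⟨3, by simp [X, Y]⟩)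

theorem IsSquare.exists_circuit_four {a b : Plane} (hs : IsSquare p a b) :
    ∃ V, IsCircuit p V ∧ V.card ≤ 4 := by
  wlog hab : 0 < cross a b generalizing a b
  · refine this hs.symm ?_
    rw [cross_swap]
    have := lt_of_le_of_ne (not_lt.1 hab) hs.cross_ne_zero
    linarith
  let X : Fin 4 → ℤ := ![1, 0, -1, 0]
  let Y : Fin 4 → ℤ := ![0, 1, 0, -1]
  refine ⟨coordVectors a b (fun i => (X i : ℝ)) (fun i => (Y i : ℝ)), ⟨?_, ?_, ?_⟩,
    card_coordVectors_le _ _ _ _⟩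
  · intro x hx
    obtain ⟨i, rfl⟩ := mem_coordVectors.1 hx
    rw [hs.map_eq]
    fin_cases i <;> simp [X, Y]
  · intro x y hxy
    obtain ⟨i, rfl, rfl⟩ := exists_of_consecutive hab (fun i => by
      have : 0 < X i * Y (i + 1) - Y i * X (i + 1) := by revert i; decide
      exact_mod_cast this) (fun i j hi hj => by
      have : 0 < X (i + 1) * Y j - Y (i + 1) * X j ∨ 0 < X j * Y i - Y j * X i := by
        revert i j; decide
      exact_mod_cast this) hxy
    rw [show (X i : ℝ) • a + (Y i : ℝ) • b - ((X (i + 1) : ℝ) • a + (Y (i + 1) : ℝ) • b) =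
      ((X i - X (i + 1) : ℤ) : ℝ) • a + ((Y i - Y (i + 1) : ℤ) : ℝ) • b by push_cast; module,
      hs.map_eq]
    have key : ∀ i : Fin 4, |X i - X (i + 1)| ≤ 1 ∧ |Y i - Y (i + 1)| ≤ 1 := by decide
    exact max_le (by exact_mod_cast (key i).1) (by exact_mod_cast (key i).2)
  · exact zero_mem_of_neg_mem (x := a) (mem_coordVectors.2 ⟨0, by simp [X, Y]⟩)
      (mem_coordVectors.2 ⟨2, by simp [X, Y]⟩)

theorem IsSquare.exists_strictCircuit_eight {a b : Plane} (hs : IsSquare p a b) :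
    ∃ V, IsStrictCircuit p V ∧ V.card ≤ 8 := by
  wlog hab : 0 < cross a b generalizing a b
  · refine this hs.symm ?_
    rw [cross_swap]
    have := lt_of_le_of_ne (not_lt.1 hab) hs.cross_ne_zero
    linarith
  -- In units of a tenth: two points on each side of the square, symmetric about the origin, with
  -- coordinate steps of at most `9`.
  let X : Fin 8 → ℤ := ![10, 10, 4, -5, -10, -10, -4, 5]
  let Y : Fin 8 → ℤ := ![-4, 5, 10, 10, 4, -5, -10, -10]
  have hab' : 0 < cross ((1 / 10 : ℝ) • a) ((1 / 10 : ℝ) • b) := by simpa using hab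
  have hmap : ∀ x y : ℤ, p ((x : ℝ) • (1 / 10 : ℝ) • a + (y : ℝ) • (1 / 10 : ℝ) • b) =
      (max |x| |y| : ℤ) / 10 := by
    intro x y
    rw [smul_smul, smul_smul, hs.map_eq, abs_mul, abs_mul, ← max_mul_of_nonneg _ _ (abs_nonneg _)]
    rw [abs_of_pos (by norm_num : (0 : ℝ) < 1 / 10)]
    push_cast; ring
  refine ⟨coordVectors ((1 / 10 : ℝ) • a) ((1 / 10 : ℝ) • b) (fun i => (X i : ℝ))
    (fun i => (Y i : ℝ)), ⟨?_, ?_, ?_⟩, card_coordVectors_le _ _ _ _⟩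
  · intro x hx
    obtain ⟨i, rfl⟩ := mem_coordVectors.1 hx
    rw [hmap]
    have key : ∀ i : Fin 8, max |X i| |Y i| = 10 := by decide
    rw [key]; norm_num
  · intro x y hxy
    obtain ⟨i, rfl, rfl⟩ := exists_of_consecutive hab' (fun i => by
      have : 0 < X i * Y (i + 1) - Y i * X (i + 1) := by revert i; decide
      exact_mod_cast this) (fun i j hi hj => by
      have : 0 < X (i + 1) * Y j - Y (i + 1) * X j ∨ 0 < X j * Y i - Y j * X i := by
        revert i j; decide
      exact_mod_cast this) hxy
    rw [show ∀ c d : Plane, (X i : ℝ) • c + (Y i : ℝ) • d -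
      ((X (i + 1) : ℝ) • c + (Y (i + 1) : ℝ) • d) =
      ((X i - X (i + 1) : ℤ) : ℝ) • c + ((Y i - Y (i + 1) : ℤ) : ℝ) • d by
        intro c d; push_cast; module, hmap]
    have key : ∀ i : Fin 8, max |X i - X (i + 1)| |Y i - Y (i + 1)| < 10 := by decide
    rw [div_lt_one (by norm_num)]
    exact_mod_cast key i
  · refine zero_mem_of_neg_mem (mem_coordVectors.2 ⟨0, rfl⟩) (mem_coordVectors.2 ⟨4, ?_⟩)
    simp only [X, Y]; simp; module

/-! ### Strict circuits of seven vectors -/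

/-- A unit vector strictly between `u` and `v` is closer to `u` than `v`, if `v` is the first unit
vector after `u` at distance `1`. -/
lemma map_sub_lt_one {u v : Plane} (hu : p u = 1) (hv : p v = 1) (hvu : p (v - u) ≤ 1)
    (hg : ∀ e : ℝ, 0 < e → 1 < p (v + e • u)) {α γ : ℝ} (hα : 0 < α) (hγ : 0 < γ)
    (hy : p (α • u + γ • v) = 1) : p (α • u + γ • v - u) < 1 := by
  rcases lt_trichotomy γ 1 with h | rfl | h
  · have hγv : p (γ • v) ≤ γ := by rw [map_smul_nonneg hγ.le, hv, mul_one]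
    rcases le_or_gt α 1 with h1 | h1
    · have e : α • u + γ • v - u =
          (1 - α) • ((1 - γ) • (-u) + γ • (v - u)) + α • (γ • v) := by module
      have h2 := map_comb_le (p := p) (a := 1 - γ) (b := γ) (x := -u) (X := 1) (by linarith) hγ.le
        (by rw [map_neg_eq_map, hu]) hvu
      have h3 := map_comb_le (p := p) (a := 1 - α) (by linarith) hα.le h2 hγv
      rw [← e] at h3
      nlinarith
    · have e : α • u + γ • v - u = (1 - α⁻¹) • (α • u + γ • v) + α⁻¹ • (γ • v) := by
        match_scalars <;> field_simp
        ring
      have hi : 0 < α⁻¹ := by positivity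
      have hi1 : α⁻¹ < 1 := inv_lt_one_of_one_lt₀ h1
      have h3 := map_comb_le (p := p) (a := 1 - α⁻¹) (by linarith) hi.le hy.le hγv
      rw [← e] at h3
      nlinarith
  · have := hg α hα
    rw [one_smul, add_comm] at hy
    linarith
  -- For `γ > 1`, a point of the segment from `u` to the given unit vector lies on the ray from `v`
  -- in the direction `u`, contradicting `hg`.
  · exfalso
    have h1 := hg ((γ - 1 + α) / γ) (div_pos (by linarith) hγ)
    have e : v + ((γ - 1 + α) / γ) • u = (1 - γ⁻¹) • u + γ⁻¹ • (α • u + γ • v) := by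
      match_scalars <;> field_simp
    have hi1 : γ⁻¹ < 1 := inv_lt_one_of_one_lt₀ h
    have := map_comb_le (p := p) (a := 1 - γ⁻¹) (b := γ⁻¹) (by linarith) (by positivity) hu.le hy.le
    rw [← e] at this
    linarith

/-- By continuity, moving `h'` slightly back towards `h` along the unit circle keeps its distance
from `z` below `1`. -/
lemma exists_near (hp : IsPlaneNorm p) {h h' z : Plane} (hh' : p h' = 1) (hc : cross h h' ≠ 0)
    (hz : p (h' - z) < 1) : ∃ α γ : ℝ, 0 < α ∧ 0 < γ ∧ p (α • h + γ • h') = 1 ∧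
      p (α • h + γ • h' - z) < 1 := by
  have hN : Continuous fun e : ℝ => p (h' + e • h) := hp.continuous.comp (by fun_prop)
  have hcont : ContinuousAt (fun e : ℝ => p ((p (h' + e • h))⁻¹ • (h' + e • h) - z)) 0 := by
    refine hp.continuous.continuousAt.comp ?_
    have hi : ContinuousAt (fun e : ℝ => (p (h' + e • h))⁻¹) 0 :=
      hN.continuousAt.inv₀ (by simp [hh'])
    have h2 : ContinuousAt (fun e : ℝ => h' + e • h) 0 := by fun_prop
    exact (hi.smul h2).sub continuousAt_const
  have hev := (hcont.eventually_lt (continuousAt_const (y := (1 : ℝ))) (by simpa [hh'] using hz)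
    ).filter_mono (nhdsWithin_le_nhds (s := Set.Ioi 0))
  obtain ⟨e, he, he0⟩ := (hev.and self_mem_nhdsWithin).exists
  have he0 : 0 < e := he0
  have hne : p (h' + e • h) ≠ 0 := by
    intro h0
    have := congrArg (cross h) (hp.eq_zero _ h0)
    simp only [cross_add_right, cross_smul_right, cross_self, mul_zero, add_zero,
      cross_zero_right] at this
    exact hc this
  have hpos : 0 < p (h' + e • h) := lt_of_le_of_ne (apply_nonneg p _) hne.symm
  have e1 : (p (h' + e • h))⁻¹ • (h' + e • h) =
      ((p (h' + e • h))⁻¹ * e) • h + (p (h' + e • h))⁻¹ • h' := by module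
  refine ⟨(p (h' + e • h))⁻¹ * e, (p (h' + e • h))⁻¹, by positivity, by positivity, ?_, ?_⟩
  · rw [← e1, map_smul_nonneg (by positivity), inv_mul_cancel₀ hne]
  · rw [← e1]; exact he

/-- The last conclusion supplies `hz` for the preceding pair of hexagon vertices, with the new
vector as `z`, so that the lemma can be iterated backwards. -/
lemma exists_near_step (hp : IsPlaneNorm p) {h h' z : Plane} (hh : p h = 1) (hh' : p h' = 1)
    (hd : p (h' - h) ≤ 1) (hc : cross h h' ≠ 0) (hg : ∀ e : ℝ, 0 < e → 1 < p (h' + e • h))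
    (hz : p (h' - z) < 1) : ∃ α γ : ℝ, 0 < α ∧ 0 < γ ∧ p (α • h + γ • h') = 1 ∧
      p (α • h + γ • h' - z) < 1 ∧ p (h - (α • h + γ • h')) < 1 := by
  obtain ⟨α, γ, hα, hγ, h1, h2⟩ := exists_near hp hh' hc hz
  refine ⟨α, γ, hα, hγ, h1, h2, ?_⟩
  rw [map_sub_rev]
  exact map_sub_lt_one hh hh' hd hg hα hγ h1

/-- The conditions `g1`, `g2`, `g3`, with their reflections in the origin, say that no side of the
hexagon can be prolonged clockwise inside the unit ball. -/
lemma exists_strictCircuit_of_hexagon (hp : IsPlaneNorm p) {u v : Plane} (hu : p u = 1)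
    (hv : p v = 1) (hvu : p (v - u) = 1) (huv : 0 < cross u v)
    (g1 : ∀ e : ℝ, 0 < e → 1 < p (v + e • u))
    (g2 : ∀ e : ℝ, 0 < e → 1 < p ((v - u) + e • v))
    (g3 : ∀ e : ℝ, 0 < e → 1 < p (-u + e • (v - u))) :
    ∃ V, IsStrictCircuit p V ∧ V.card ≤ 7 := by
  have hu' : p (-u) = 1 := by rwa [map_neg_eq_map]
  have hv' : p (-v) = 1 := by rwa [map_neg_eq_map]
  have huv' : p (u - v) = 1 := by rwa [map_sub_rev]
  have g4 : ∀ e : ℝ, 0 < e → 1 < p (-v + e • -u) := fun e he => by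
    rw [show -v + e • -u = -(v + e • u) by module, map_neg_eq_map]; exact g1 e he
  have g5 : ∀ e : ℝ, 0 < e → 1 < p (u - v + e • -v) := fun e he => by
    rw [show u - v + e • -v = -((v - u) + e • v) by module, map_neg_eq_map]; exact g2 e he
  have g6 : ∀ e : ℝ, 0 < e → 1 < p (u + e • (u - v)) := fun e he => by
    rw [show u + e • (u - v) = -(-u + e • (v - u)) by module, map_neg_eq_map]; exact g3 e he
  have hvu0 : cross v u ≠ 0 := by rw [cross_swap]; simpa using huv.ne'
  -- The six new vectors are chosen from the last, just before `u`, back to the first, just before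
  -- `v`; each only has to be close enough to the one chosen before it.
  obtain ⟨a6, c6, ha6, hc6, n6, d60, d6⟩ := exists_near_step hp (h := u - v) (h' := u) (z := u)
    huv' hu (by simpa using hv.le) (by simpa using hvu0) g6 (by simp)
  obtain ⟨a5, c5, ha5, hc5, n5, d56, d5⟩ := exists_near_step hp (h := -v) (h' := u - v)
    hv' huv' (by simpa using hu.le) (by simpa using hvu0) g5 d6
  obtain ⟨a4, c4, ha4, hc4, n4, d45, d4⟩ := exists_near_step hp (h := -u) (h' := -v)
    hu' hv' (by rw [sub_neg_eq_add, neg_add_eq_sub]; exact huv'.le) (by simpa using huv.ne') g4 d5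
  obtain ⟨a3, c3, ha3, hc3, n3, d34, d3⟩ := exists_near_step hp (h := v - u) (h' := -u)
    hvu hu' (by rw [show -u - (v - u) = -v by abel]; exact hv'.le) (by simpa using hvu0) g3 d4
  obtain ⟨a2, c2, ha2, hc2, n2, d23, d2⟩ := exists_near_step hp (h := v) (h' := v - u)
    hv hvu (by simpa using hu'.le) (by simpa using hvu0) g2 d3
  obtain ⟨a1, c1, ha1, hc1, n1, d12, d1⟩ := exists_near_step hp (h := u) (h' := v)
    hu hv hvu.le huv.ne' g1 d2
  have e2 : a2 • v + c2 • (v - u) = (-c2) • u + (a2 + c2) • v := by module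
  have e3 : a3 • (v - u) + c3 • -u = (-a3 - c3) • u + a3 • v := by module
  have e4 : a4 • -u + c4 • -v = (-a4) • u + (-c4) • v := by module
  have e5 : a5 • -v + c5 • (u - v) = c5 • u + (-a5 - c5) • v := by module
  have e6 : a6 • (u - v) + c6 • u = (a6 + c6) • u + (-a6) • v := by module
  have e0 : u = (1 : ℝ) • u + (0 : ℝ) • v := by module
  let X : Fin 7 → ℝ := ![1, a1, -c2, -a3 - c3, -a4, c5, a6 + c6]
  let Y : Fin 7 → ℝ := ![0, c1, a2 + c2, a3, -c4, -a5 - c5, -a6]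
  have hdist : ∀ i, p (X i • u + Y i • v - (X (i + 1) • u + Y (i + 1) • v)) < 1 := by
    intro i
    fin_cases i
    · change p ((1 : ℝ) • u + (0 : ℝ) • v - (a1 • u + c1 • v)) < 1
      rw [← e0]; exact d1
    · change p (a1 • u + c1 • v - ((-c2) • u + (a2 + c2) • v)) < 1
      rw [← e2]; exact d12
    · change p ((-c2) • u + (a2 + c2) • v - ((-a3 - c3) • u + a3 • v)) < 1
      rw [← e2, ← e3]; exact d23
    · change p ((-a3 - c3) • u + a3 • v - ((-a4) • u + (-c4) • v)) < 1
      rw [← e3, ← e4]; exact d34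
    · change p ((-a4) • u + (-c4) • v - (c5 • u + (-a5 - c5) • v)) < 1
      rw [← e4, ← e5]; exact d45
    · change p (c5 • u + (-a5 - c5) • v - ((a6 + c6) • u + (-a6) • v)) < 1
      rw [← e5, ← e6]; exact d56
    · change p ((a6 + c6) • u + (-a6) • v - ((1 : ℝ) • u + (0 : ℝ) • v)) < 1
      rw [← e6, ← e0]; exact d60
  refine ⟨coordVectors u v X Y, ⟨?_, ?_, ?_⟩, card_coordVectors_le _ _ _ _⟩
  · intro x hx
    obtain ⟨i, rfl⟩ := mem_coordVectors.1 hx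
    fin_cases i
    · change p ((1 : ℝ) • u + (0 : ℝ) • v) = 1
      rw [← e0]; exact hu
    · exact n1
    · change p ((-c2) • u + (a2 + c2) • v) = 1
      rw [← e2]; exact n2
    · change p ((-a3 - c3) • u + a3 • v) = 1
      rw [← e3]; exact n3
    · change p ((-a4) • u + (-c4) • v) = 1
      rw [← e4]; exact n4
    · change p (c5 • u + (-a5 - c5) • v) = 1
      rw [← e5]; exact n5
    · change p ((a6 + c6) • u + (-a6) • v) = 1
      rw [← e6]; exact n6
  · intro x y hxy
    obtain ⟨i, rfl, rfl⟩ := exists_of_consecutive huv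
      (fun i => by fin_cases i <;> dsimp [X, Y] <;> ring_nf <;> positivity)
      (fun i j hi hj => by
        fin_cases i <;> fin_cases j <;> first
        | exact absurd rfl hi
        | exact absurd rfl hj
        | (left; dsimp [X, Y]; ring_nf; positivity)
        | (right; dsimp [X, Y]; ring_nf; positivity)) hxy
    exact hdist i
  · refine zero_mem_of_cross_pos (mem_coordVectors.2 ⟨0, rfl⟩) (mem_coordVectors.2 ⟨2, rfl⟩)
      (mem_coordVectors.2 ⟨4, rfl⟩) ?_ ?_ ?_ <;> rw [cross_coords] <;> refine mul_pos ?_ huv <;>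
      dsimp [X, Y] <;> ring_nf <;> positivity

/-- The hexagons with a vertex on a long side of the unit ball. -/
lemma exists_hexagon_of_side (hp : IsPlaneNorm p) {r z : Plane} (hz : p z = 1)
    (hrz : 0 < cross r z) (hsupp : ∀ x y : ℝ, |x| ≤ p (x • r + y • z)) {l m : ℝ}
    (hS : ∀ t, p (r + t • z) ≤ 1 ↔ l ≤ t ∧ t ≤ m) (hlm : 1 < m - l) {s : ℝ} (hs1 : m - 1 < s)
    (hs2 : s < l + 1) :
    ∃ (v : Plane) (x : ℝ), p (r + s • z) = 1 ∧ p v = 1 ∧ p (v - (r + s • z)) = 1 ∧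
      0 < cross (r + s • z) v ∧ 0 < x ∧ x < 1 ∧
      (∀ e : ℝ, 0 < e → 1 < p (v - (r + s • z) + e • v)) ∧
      (∀ e : ℝ, 0 < e → 1 < p (-(r + s • z) + e • (v - (r + s • z)))) ∧
      ((∀ e : ℝ, 0 < e → 1 < p (v + e • (r + s • z))) ∨ z = v - x • (r + s • z)) := by
  have hu : p (r + s • z) = 1 := by
    apply le_antisymm ((hS s).2 ⟨by linarith, by linarith⟩)
    simpa using hsupp 1 s
  obtain ⟨v, hv, hvu, huv⟩ := exists_hexagon hp hu
  obtain ⟨x, y, hxy⟩ := exists_coords hrz.ne' v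
  have hxle : x ≤ 1 := by
    have := hsupp x y
    rw [← hxy, hv] at this
    exact (le_abs_self x).trans this
  have e1 : v - (r + s • z) = (x - 1) • r + (y - s) • z := by rw [hxy]; module
  have hx0 : 0 ≤ x := by
    have := hsupp (x - 1) (y - s)
    rw [← e1, hvu] at this
    linarith [neg_abs_le (x - 1)]
  -- If `x = 1`, then `v` is on the side at distance `1` from `r + s • z`, but `s` is less than `1`
  -- away from both ends. For `x = 0` the same holds for `r + s • z - v`.
  have hx1 : x ≠ 1 := by
    rintro rfl
    rw [e1, sub_self, zero_smul, zero_add, map_smul_eq_mul, hz, mul_one, Real.norm_eq_abs] at hvu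
    have h1 := (hS y).1 (by rw [← one_smul ℝ r, ← hxy, hv])
    rcases (abs_eq one_pos.le).1 hvu with h | h
    · linarith [h1.2]
    · linarith [h1.1]
  have hx0' : x ≠ 0 := by
    rintro rfl
    rw [zero_smul, zero_add] at hxy
    rw [hxy, map_smul_eq_mul, hz, mul_one, Real.norm_eq_abs] at hv
    have h2 := (hS (s - y)).1 (by
      rw [← hvu, ← map_neg_eq_map, e1]
      apply le_of_eq; congr 1; module)
    rcases (abs_eq one_pos.le).1 hv with h | h
    · linarith [h2.1]
    · linarith [h2.2]
  have hxpos : 0 < x := lt_of_le_of_ne hx0 hx0'.symm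
  have hxlt : x < 1 := lt_of_le_of_ne hxle hx1
  have hyx : 0 < y - s * x := by
    rw [hxy, show r + s • z = (1 : ℝ) • r + s • z by module, cross_coords] at huv
    have := pos_of_mul_pos_left huv hrz.le
    linarith
  refine ⟨v, x, hu, hv, hvu, huv, hxpos, hxlt, ?_, ?_, ?_⟩
  · intro e he
    by_contra! hle
    have hwv : cross v z ≠ 0 := by
      rw [hxy]
      simpa using ⟨hx0', hrz.ne'⟩
    -- The functional with value `1` at `v - u` and `0` at `v`, where `u = r + s • z`, is bounded by
    -- the norm and equals `1` at `-u`, an interior point of the opposite side. So it is constant on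
    -- that side, its value `c` at `z` vanishes, and `z` is parallel to `v`.
    have hsw := abs_le_map_of_side (p := p) (r := v - (r + s • z)) (z := v) one_pos he hvu.ge
      (by rw [one_smul, sub_sub_cancel_left, map_neg_eq_map]; exact hu.le) hle
    obtain ⟨c, d, hcd⟩ := exists_coords (u := v - (r + s • z)) (v := v)
      (by rw [cross_sub_left, cross_self, zero_sub]; exact neg_ne_zero.2 huv.ne') z
    have e3 : -(r + l • z) = (1 + (s - l) * c) • (v - (r + s • z)) + ((s - l) * d - 1) • v := by
      have : -(r + l • z) = (v - (r + s • z)) + (s - l) • z - v := by module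
      rw [this]; nth_rewrite 2 [hcd]; module
    have e4 : -(r + m • z) = (1 - (m - s) * c) • (v - (r + s • z)) + (-(m - s) * d - 1) • v := by
      have : -(r + m • z) = (v - (r + s • z)) - (m - s) • z - v := by module
      rw [this]; nth_rewrite 2 [hcd]; module
    have k3 := hsw (1 + (s - l) * c) ((s - l) * d - 1)
    have k4 := hsw (1 - (m - s) * c) (-(m - s) * d - 1)
    rw [← e3, map_neg_eq_map] at k3
    rw [← e4, map_neg_eq_map] at k4
    have k5 := (le_abs_self _).trans (k3.trans ((hS l).2 ⟨le_rfl, by linarith⟩))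
    have k6 := (le_abs_self _).trans (k4.trans ((hS m).2 ⟨by linarith, le_rfl⟩))
    have hc : c = 0 := by
      apply le_antisymm
      · by_contra! hc
        have := mul_pos (show 0 < s - l by linarith) hc
        linarith
      · by_contra! hc
        have := mul_pos_of_neg_of_neg (show -(m - s) < 0 by linarith) hc
        linarith
    rw [hc, zero_smul, zero_add] at hcd
    apply hwv
    rw [hcd]; simp
  · intro e he
    -- The coordinate along `r` is already less than `-1`.
    have := hsupp (-1 + e * (x - 1)) (-s + e * (y - s))
    rw [show (-1 + e * (x - 1)) • r + (-s + e * (y - s)) • z =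
      -(r + s • z) + e • (v - (r + s • z)) by rw [e1]; module] at this
    have h2 := neg_abs_le (-1 + e * (x - 1))
    nlinarith
  · by_contra! hcon
    obtain ⟨⟨e, he, hle⟩, hne⟩ := hcon
    apply hne
    -- The vector `v - x • (r + s • z)` is a positive multiple of `z`. It has norm at least `1` by
    -- the support line at `v`, and at most `1` as a convex combination of `v` and `v - (r + s •
    -- z)`; hence it is `z`.
    have hsv := abs_le_map_of_side (p := p) (r := v) (z := r + s • z) one_pos he hv.ge
      (by rw [one_smul]; exact hvu.le) hle
    have e2 : v - x • (r + s • z) = (y - s * x) • z := by rw [hxy]; module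
    have h1 := hsv 1 (-x)
    rw [show (1 : ℝ) • v + (-x) • (r + s • z) = v - x • (r + s • z) by module, e2,
      map_smul_nonneg hyx.le, hz, abs_one, mul_one] at h1
    have h2 := map_comb_le (p := p) (a := 1 - x) (by linarith) hx0 hv.le hvu.le
    rw [show (1 - x) • v + x • (v - (r + s • z)) = v - x • (r + s • z) by module, e2,
      map_smul_nonneg hyx.le, hz] at h2
    rw [e2, show y - s * x = 1 by linarith, one_smul]

lemma exists_good_hexagon_of_side (hp : IsPlaneNorm p) (hsq : ∀ u v, ¬ IsSquare p u v)
    {r z : Plane} (hr : p r = 1) (hz : p z = 1) (hrz : 0 < cross r z) {e : ℝ} (he : 0 < e)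
    (h1 : p (r - e • z) ≤ 1) (h2 : p (r + z) ≤ 1) :
    ∃ u v, p u = 1 ∧ p v = 1 ∧ p (v - u) = 1 ∧ 0 < cross u v ∧
      (∀ e : ℝ, 0 < e → 1 < p (v + e • u)) ∧ (∀ e : ℝ, 0 < e → 1 < p (v - u + e • v)) ∧
      (∀ e : ℝ, 0 < e → 1 < p (-u + e • (v - u))) := by
  have hsupp := abs_le_map_of_side he one_pos hr.ge h1 (by rwa [one_smul])
  let A : Set ℝ := {t | p (r + t • z) ≤ 1}
  have hA : IsCompact A := by
    apply Metric.isCompact_of_isClosed_isBounded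
    · exact isClosed_le (hp.continuous.comp (by fun_prop)) continuous_const
    · refine (Metric.isBounded_Icc (-2 : ℝ) 2).subset fun t ht => ?_
      have h3 := map_sub_le_add p (r + t • z) r
      rw [add_sub_cancel_left, map_smul_eq_mul, hz, hr, mul_one, Real.norm_eq_abs] at h3
      have ht : p (r + t • z) ≤ 1 := ht
      exact abs_le.1 (by linarith)
  have h1A : (1 : ℝ) ∈ A := by simpa [A] using h2
  have heA : -e ∈ A := by simpa [A, sub_eq_add_neg] using h1
  have hl := hA.sInf_mem ⟨_, h1A⟩
  have hm := hA.sSup_mem ⟨_, h1A⟩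
  have hS : ∀ t, p (r + t • z) ≤ 1 ↔ sInf A ≤ t ∧ t ≤ sSup A := by
    intro t
    refine ⟨fun h => ⟨csInf_le hA.bddBelow h, le_csSup hA.bddAbove h⟩, fun ⟨h3, h4⟩ => ?_⟩
    have hconv : Convex ℝ A := by
      intro a ha b hb x y hx hy hxy
      have h5 := map_comb_le (p := p) hx hy ha hb
      rw [mul_one, mul_one, hxy] at h5
      have e5 : x • (r + a • z) + y • (r + b • z) = r + (x • a + y • b) • z := by
        rw [show y = 1 - x by linarith]; simp only [smul_eq_mul]; module
      rw [e5] at h5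
      exact h5
    exact hconv.ordConnected.out hl hm ⟨h3, h4⟩
  have hle := (hS _).1 heA
  have hle1 := (hS _).1 h1A
  generalize sInf A = l at *
  generalize sSup A = m at *
  -- Otherwise the midpoint of the side and `z` would be midpoints of the sides of a square.
  have hlm : m - l < 2 := by
    by_contra! hc
    have h5 : p (r + ((l + m) / 2) • z) = 1 :=
      le_antisymm ((hS _).2 ⟨by linarith, by linarith⟩) (by simpa using hsupp 1 ((l + m) / 2))
    refine hsq (r + ((l + m) / 2) • z) z ⟨h5, hz, ?_, ?_⟩
    · rw [show r + ((l + m) / 2) • z + z = r + ((l + m) / 2 + 1) • z by module]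
      exact (hS _).2 ⟨by linarith, by linarith⟩
    · rw [show r + ((l + m) / 2) • z - z = r + ((l + m) / 2 - 1) • z by module]
      exact (hS _).2 ⟨by linarith, by linarith⟩
  -- Two positions of the vertex are tried. If both fail, `z` lies inside a segment of the ball
  -- parallel to `r + s • z`, and the other hexagon's vertex `v'` is beyond the support line through
  -- that segment.
  obtain ⟨s, hs1, hs2⟩ := exists_between (show m - 1 < l + 1 by linarith)
  obtain ⟨s', hs1', hs2'⟩ := exists_between hs2
  obtain ⟨v, x, hu, hv, hvu, huv, hx0, hx1, g2, g3, g1 | g1⟩ :=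
    exists_hexagon_of_side hp hz hrz hsupp hS (by linarith) hs1 hs2
  · exact ⟨_, v, hu, hv, hvu, huv, g1, g2, g3⟩
  obtain ⟨v', x', hu', hv', hvu', huv', hx0', hx1', g2', g3', g1' | g1'⟩ :=
    exists_hexagon_of_side hp hz hrz hsupp hS (by linarith) (hs1.trans hs1') hs2'
  · exact ⟨_, v', hu', hv', hvu', huv', g1', g2', g3'⟩
  exfalso
  have k1 : p (z + x • (r + s • z)) ≤ 1 := by
    rw [show z + x • (r + s • z) = v by nth_rewrite 1 [g1]; module]; exact hv.le
  have k2 : p (z - (1 - x) • (r + s • z)) ≤ 1 := by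
    rw [show z - (1 - x) • (r + s • z) = v - (r + s • z) by nth_rewrite 1 [g1]; module]
    exact hvu.le
  have k := abs_le_map_of_side (p := p) (sub_pos.2 hx1) hx0 hz.ge k2 k1 (1 + x' * (s' - s)) x'
  rw [show (1 + x' * (s' - s)) • z + x' • (r + s • z) = z + x' • (r + s' • z) by module,
    show z + x' • (r + s' • z) = v' by nth_rewrite 1 [g1']; module, hv'] at k
  have := le_abs_self (1 + x' * (s' - s))
  nlinarith

/-- Any hexagon serves unless one of its sides can be prolonged; then the unit ball has a side
longer than `1`, and the hexagon is replaced. -/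
theorem exists_strictCircuit_seven (hp : IsPlaneNorm p) (hsq : ∀ u v, ¬ IsSquare p u v) :
    ∃ V, IsStrictCircuit p V ∧ V.card ≤ 7 := by
  have bad : ∀ {z w : Plane}, p z = 1 → p w = 1 → p (w - z) = 1 → 0 < cross z w →
      (∃ e : ℝ, 0 < e ∧ p (w + e • z) ≤ 1) → ∃ V, IsStrictCircuit p V ∧ V.card ≤ 7 := by
    intro z w hz hw hwz hzw ⟨e, he, hle⟩
    -- The side opposite to the prolonged one is used, because it has the required orientation.
    obtain ⟨u, v, hu, hv, hvu, huv, g1, g2, g3⟩ := exists_good_hexagon_of_side hp hsq (r := -w)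
      (by simpa using hw) hz (by rw [cross_neg_left, ← cross_swap]; exact hzw) he
      (by rw [show -w - e • z = -(w + e • z) by abel, map_neg_eq_map]; exact hle)
      (by rw [neg_add_eq_sub, map_sub_rev]; exact hwz.le)
    exact exists_strictCircuit_of_hexagon hp hu hv hvu huv g1 g2 g3
  obtain ⟨u, hu⟩ := exists_unit hp
  obtain ⟨v, hv, hvu, huv⟩ := exists_hexagon hp hu
  by_cases g1 : ∀ e : ℝ, 0 < e → 1 < p (v + e • u)
  swap
  · push Not at g1
    exact bad hu hv hvu huv g1
  by_cases g2 : ∀ e : ℝ, 0 < e → 1 < p (v - u + e • v)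
  swap
  · push Not at g2
    exact bad hv hvu (by simpa using hu) (by simpa [cross_swap u v] using huv) g2
  by_cases g3 : ∀ e : ℝ, 0 < e → 1 < p (-u + e • (v - u))
  swap
  · push Not at g3
    exact bad hvu (by simpa using hu)
      (by rw [show -u - (v - u) = -v by abel, map_neg_eq_map]; exact hv)
      (by simpa [cross_swap u v] using huv) g3
  exact exists_strictCircuit_of_hexagon hp hu hv hvu huv g1 g2 g3

/-! ### The norm of a convex disc -/

/-- `p` is the norm whose unit ball is the central symmetral of `C`. -/
structure IsNormOf (p : Seminorm ℝ Plane) (C : Set Plane) : Prop where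
  isPlaneNorm : IsPlaneNorm p
  eq_gauge : ∀ x, p x = gauge (symmetral C) x
  le_two_iff : ∀ x, p x ≤ 2 ↔ x ∈ C - C
  lt_two_iff : ∀ x, p x < 2 ↔ x ∈ interior C - interior C

lemma IsConvexDisc.exists_isNormOf {C : Set Plane} (hC : IsConvexDisc C) : ∃ p, IsNormOf p C := by
  obtain ⟨c, hc⟩ := hC.interior_nonempty
  have hsub : interior C - interior C ⊆ C - C := Set.sub_subset_sub interior_subset interior_subset
  have hopen : IsOpen (interior C - interior C) := isOpen_interior.sub_right
  have h0 : (0 : Plane) ∈ interior C - interior C := ⟨c, hc, c, hc, sub_self c⟩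
  have hnhds : C - C ∈ nhds (0 : Plane) := Filter.mem_of_superset (hopen.mem_nhds h0) hsub
  have hcomp : IsCompact (C - C) := by
    rw [sub_eq_add_neg]; exact hC.isCompact.add hC.isCompact.neg
  have hK : symmetral C ∈ nhds (0 : Plane) := by
    have := (set_smul_mem_nhds_zero_iff (s := C - C) (c := (1 / 2 : ℝ)) (by norm_num)).2 hnhds
    exact this
  have hKconv : Convex ℝ (symmetral C) := (hC.convex.sub hC.convex).smul _
  have hKcomp : IsCompact (symmetral C) := hcomp.smul _
  have hbal : Balanced ℝ (symmetral C) := by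
    rw [balanced_iff_neg_mem hKconv]
    rintro _ ⟨_, ⟨a, ha, b, hb, rfl⟩, rfl⟩
    exact ⟨b - a, ⟨b, hb, a, ha, rfl⟩, by simp only; module⟩
  have habs : Absorbent ℝ (symmetral C) := absorbent_nhds_zero hK
  let p := gaugeSeminorm hbal hKconv habs
  have hpg : ∀ x, p x = gauge (symmetral C) x := fun x => rfl
  have hpn : IsPlaneNorm p := by
    refine ⟨fun x hx => ?_, ?_⟩
    · exact (gauge_eq_zero habs ((NormedSpace.isVonNBounded_iff ℝ).2 hKcomp.isBounded)).1 hx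
    · exact continuous_gauge hKconv hK
  have hle : ∀ x, p x ≤ 2 ↔ x ∈ C - C := by
    intro x
    have h1 : p ((1 / 2 : ℝ) • x) ≤ 1 ↔ (1 / 2 : ℝ) • x ∈ symmetral C := by
      rw [hpg, gauge_le_one_iff_mem_closure hKconv hK, hKcomp.isClosed.closure_eq]
    rw [symmetral, Set.smul_mem_smul_set_iff₀ (by norm_num), map_smul_nonneg (by norm_num)] at h1
    rw [← h1]
    constructor <;> intro h <;> linarith
  refine ⟨p, hpn, hpg, hle, fun x => ⟨fun hx => ?_, fun hx => ?_⟩⟩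
  -- Write `x` as `ρ • (a - b)` with `a`, `b` in `C` and `ρ < 1`; contracting `a` and `b` towards
  -- the interior point `c` by the factor `ρ` gives interior points with difference `x`.
  · obtain ⟨ρ, h1, h2⟩ := exists_between (show p x / 2 < 1 by linarith)
    have hρ : 0 < ρ := lt_of_le_of_lt (by have := apply_nonneg p x; positivity) h1
    have h3 : p (ρ⁻¹ • x) ≤ 2 := by
      rw [map_smul_nonneg (by positivity), inv_mul_le_iff₀ hρ]; linarith
    obtain ⟨a, ha, b, hb, hab⟩ := (hle _).1 h3
    refine ⟨_, hC.convex.combo_self_interior_mem_interior ha hc hρ.le (sub_pos.2 h2) (by ring),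
      _, hC.convex.combo_self_interior_mem_interior hb hc hρ.le (sub_pos.2 h2) (by ring), ?_⟩
    have : x = ρ • (a - b) := by
      simp only at hab
      rw [hab, smul_smul, mul_inv_cancel₀ hρ.ne', one_smul]
    rw [this]; simp only; module
  -- The set of differences of interior points is open, so it contains `t • x` for some `t > 1`.
  · have hcont : ContinuousAt (fun t : ℝ => t • x) 1 := by fun_prop
    have hev := (hcont.eventually (hopen.mem_nhds (by simpa using hx))).filter_mono
      (nhdsWithin_le_nhds (s := Set.Ioi 1))
    obtain ⟨t, ht, ht1⟩ := (hev.and self_mem_nhdsWithin).exists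
    have ht1 : 1 < t := ht1
    have h3 := (hle _).2 (hsub ht)
    rw [map_smul_nonneg (by linarith)] at h3
    by_contra! hcon
    nlinarith

lemma IsNormOf.not_disjoint_iff {C : Set Plane} (h : IsNormOf p C) (u v : Plane) :
    ¬ Disjoint (u +ᵥ C) (v +ᵥ C) ↔ p (u - v) ≤ 2 := by
  rw [Set.not_disjoint_iff, h.le_two_iff]
  constructor
  · rintro ⟨_, ⟨a, ha, rfl⟩, ⟨b, hb, hab⟩⟩
    simp only [vadd_eq_add] at hab
    refine ⟨b, hb, a, ha, ?_⟩
    have : b = u + a - v := by rw [← hab]; abel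
    simp only [this]; abel
  · rintro ⟨b, hb, a, ha, hab⟩
    simp only at hab
    refine ⟨u + a, ⟨a, ha, rfl⟩, b, hb, ?_⟩
    have : b = u - v + a := by rw [← hab]; abel
    simp only [vadd_eq_add, this]; abel

lemma IsNormOf.overlap_iff {C : Set Plane} (h : IsNormOf p C) (u v : Plane) :
    Overlap (u +ᵥ C) (v +ᵥ C) ↔ p (u - v) < 2 := by
  rw [Overlap, interior_vadd, interior_vadd, h.lt_two_iff]
  constructor
  · rintro ⟨_, ⟨a, ha, rfl⟩, ⟨b, hb, hab⟩⟩
    simp only [vadd_eq_add] at hab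
    refine ⟨b, hb, a, ha, ?_⟩
    have : b = u + a - v := by rw [← hab]; abel
    simp only [this]; abel
  · rintro ⟨b, hb, a, ha, hab⟩
    simp only at hab
    refine ⟨u + a, ⟨a, ha, rfl⟩, b, hb, ?_⟩
    have : b = u - v + a := by rw [← hab]; abel
    simp only [vadd_eq_add, this]; abel

lemma IsNormOf.touch_iff {C : Set Plane} (h : IsNormOf p C) (v : Plane) :
    Touch (v +ᵥ C) C ↔ p v = 2 := by
  have h1 := h.not_disjoint_iff v 0
  have h2 := h.overlap_iff v 0
  rw [zero_vadd, sub_zero] at h1 h2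
  rw [Touch, h2, ← Set.not_disjoint_iff_nonempty_inter, h1, not_lt]
  exact ⟨fun h => le_antisymm h.1 h.2, fun h => ⟨h.le, h.ge⟩⟩

open Classical in
lemma consecutive_of_image_smul {V : Finset Plane} {c : ℝ} (hc : 0 < c) {u v : Plane}
    (h : Consecutive (V.image (c • ·)) u v) :
    ∃ x y, u = c • x ∧ v = c • y ∧ Consecutive V x y := by
  obtain ⟨hu, hv, hne, hw⟩ := h
  obtain ⟨x, hx, rfl⟩ := Finset.mem_image.1 hu
  obtain ⟨y, hy, rfl⟩ := Finset.mem_image.1 hv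
  refine ⟨x, y, rfl, rfl, hx, hy, fun h => hne (by rw [h]), fun w hwV hccw => ?_⟩
  refine hw _ (Finset.mem_image_of_mem _ hwV) ?_
  simpa [CCW, hc] using hccw

open Classical in
lemma zero_mem_image_smul {V : Finset Plane} (h : (0 : Plane) ∈ convexHull ℝ (V : Set Plane))
    (c : ℝ) : (0 : Plane) ∈ convexHull ℝ ((V.image (c • ·) : Finset Plane) : Set Plane) := by
  rw [Finset.coe_image, Set.image_smul, convexHull_smul]
  exact ⟨0, h, by simp⟩

lemma card_image_smul [DecidableEq Plane] (V : Finset Plane) {c : ℝ} (hc : c ≠ 0) :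
    (V.image (c • ·)).card = V.card :=
  Finset.card_image_of_injective _ (smul_right_injective _ hc)

lemma IsNormOf.isMinSize_dualFamily {C : Set Plane} (h : IsNormOf p C) (n : ℕ) :
    IsMinSize (IsDualFamily C) n ↔ IsMinSize (IsCircuit p) n := by
  classical
  have : {m | ∃ V, IsDualFamily C V ∧ V.card = m} = {m | ∃ V, IsCircuit p V ∧ V.card = m} := by
    ext m
    constructor
    · rintro ⟨V, hV, rfl⟩
      refine ⟨V.image ((1 / 2 : ℝ) • ·), ⟨?_, ?_, zero_mem_image_smul hV.zero_mem _⟩,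
        card_image_smul V (by norm_num)⟩
      · intro v hv
        obtain ⟨x, hx, rfl⟩ := Finset.mem_image.1 hv
        rw [map_smul_nonneg (by norm_num), (h.touch_iff x).1 (hV.touch x hx)]; norm_num
      · intro u v huv
        obtain ⟨x, y, rfl, rfl, hxy⟩ := consecutive_of_image_smul (by norm_num) huv
        rw [← smul_sub, map_smul_nonneg (by norm_num)]
        linarith [(h.not_disjoint_iff x y).1 (hV.consecutive x y hxy)]
    · rintro ⟨V, hV, rfl⟩
      refine ⟨V.image ((2 : ℝ) • ·), ⟨?_, ?_, zero_mem_image_smul hV.zero_mem _⟩,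
        card_image_smul V (by norm_num)⟩
      · intro v hv
        obtain ⟨x, hx, rfl⟩ := Finset.mem_image.1 hv
        rw [h.touch_iff, map_smul_nonneg (by norm_num), hV.unit x hx, mul_one]
      · intro u v huv
        obtain ⟨x, y, rfl, rfl, hxy⟩ := consecutive_of_image_smul (by norm_num) huv
        rw [h.not_disjoint_iff, ← smul_sub, map_smul_nonneg (by norm_num)]
        linarith [hV.consecutive x y hxy]
  rw [IsMinSize, IsMinSize, this]

lemma IsNormOf.isMinSize_dualStrictFamily {C : Set Plane} (h : IsNormOf p C) (n : ℕ) :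
    IsMinSize (IsDualStrictFamily C) n ↔ IsMinSize (IsStrictCircuit p) n := by
  classical
  have : {m | ∃ V, IsDualStrictFamily C V ∧ V.card = m} =
      {m | ∃ V, IsStrictCircuit p V ∧ V.card = m} := by
    ext m
    constructor
    · rintro ⟨V, hV, rfl⟩
      refine ⟨V.image ((1 / 2 : ℝ) • ·), ⟨?_, ?_, zero_mem_image_smul hV.zero_mem _⟩,
        card_image_smul V (by norm_num)⟩
      · intro v hv
        obtain ⟨x, hx, rfl⟩ := Finset.mem_image.1 hv
        rw [map_smul_nonneg (by norm_num), (h.touch_iff x).1 (hV.touch x hx)]; norm_num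
      · intro u v huv
        obtain ⟨x, y, rfl, rfl, hxy⟩ := consecutive_of_image_smul (by norm_num) huv
        rw [← smul_sub, map_smul_nonneg (by norm_num)]
        linarith [(h.overlap_iff x y).1 (hV.consecutive x y hxy)]
    · rintro ⟨V, hV, rfl⟩
      refine ⟨V.image ((2 : ℝ) • ·), ⟨?_, ?_, zero_mem_image_smul hV.zero_mem _⟩,
        card_image_smul V (by norm_num)⟩
      · intro v hv
        obtain ⟨x, hx, rfl⟩ := Finset.mem_image.1 hv
        rw [h.touch_iff, map_smul_nonneg (by norm_num), hV.unit x hx, mul_one]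
      · intro u v huv
        obtain ⟨x, y, rfl, rfl, hxy⟩ := consecutive_of_image_smul (by norm_num) huv
        rw [h.overlap_iff, ← smul_sub, map_smul_nonneg (by norm_num)]
        linarith [hV.consecutive x y hxy]
  rw [IsMinSize, IsMinSize, this]

lemma IsNormOf.isUnitCircuit_iff {C : Set Plane} (h : IsNormOf p C) (V : Finset Plane) :
    IsUnitCircuit C V ↔ IsCircuit p V := by
  constructor <;> rintro ⟨h1, h2, h3⟩
  · exact ⟨by simpa only [h.eq_gauge] using h1, by simpa only [h.eq_gauge] using h2, h3⟩
  · exact ⟨by simpa only [h.eq_gauge] using h1, by simpa only [h.eq_gauge] using h2, h3⟩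

lemma IsNormOf.isStrictUnitCircuit_iff {C : Set Plane} (h : IsNormOf p C) (V : Finset Plane) :
    IsStrictUnitCircuit C V ↔ IsStrictCircuit p V := by
  constructor <;> rintro ⟨h1, h2, h3⟩
  · exact ⟨by simpa only [h.eq_gauge] using h1, by simpa only [h.eq_gauge] using h2, h3⟩
  · exact ⟨by simpa only [h.eq_gauge] using h1, by simpa only [h.eq_gauge] using h2, h3⟩

/-- An upper bound on the size of the example suffices, so the constructions need not show that
their vectors are distinct. -/
lemma isMinSize_of_bounds {P : Finset Plane → Prop} {n : ℕ} (h1 : ∀ V, P V → n ≤ V.card)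
    (h2 : ∃ V, P V ∧ V.card ≤ n) : IsMinSize P n := by
  obtain ⟨V, hV, hc⟩ := h2
  refine ⟨⟨V, hV, le_antisymm hc (h1 V hV)⟩, ?_⟩
  rintro _ ⟨W, hW, rfl⟩
  exact h1 W hW

/-! ### Parallelograms and square norms -/

lemma IsNormOf.exists_isSquare {C : Set Plane} (h : IsNormOf p C) (hC : IsParallelogram C) :
    ∃ u v, IsSquare p u v := by
  obtain ⟨q, a, b, hli, rfl⟩ := hC
  rw [LinearIndependent.pair_iff] at hli
  have hmem : ∀ {s t : ℝ}, 0 ≤ s → s ≤ 1 → 0 ≤ t → t ≤ 1 → q + s • a + t • b ∈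
      {x | ∃ s ∈ Set.Icc (0 : ℝ) 1, ∃ t ∈ Set.Icc (0 : ℝ) 1, x = q + s • a + t • b} :=
    fun h1 h2 h3 h4 => ⟨_, ⟨h1, h2⟩, _, ⟨h3, h4⟩, rfl⟩
  have hbound : ∀ α β : ℝ, p (α • a + β • b) ≤ 2 → α ≤ 1 ∧ β ≤ 1 := by
    intro α β hle
    obtain ⟨_, ⟨s, hs, t, ht, rfl⟩, _, ⟨s', hs', t', ht', rfl⟩, heq⟩ := (h.le_two_iff _).1 hle
    simp only at heq
    obtain ⟨h1, h2⟩ := hli (s - s' - α) (t - t' - β) (by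
      have : (s - s' - α) • a + (t - t' - β) • b =
        q + s • a + t • b - (q + s' • a + t' • b) - (α • a + β • b) := by module
      rw [this, heq, sub_self])
    exact ⟨by linarith [hs.2, hs'.1], by linarith [ht.2, ht'.1]⟩
  have ha : p a ≤ 2 := (h.le_two_iff _).2 ⟨_, hmem zero_le_one le_rfl le_rfl zero_le_one, _,
    hmem le_rfl zero_le_one le_rfl zero_le_one, by simp only; module⟩
  have hb : p b ≤ 2 := (h.le_two_iff _).2 ⟨_, hmem le_rfl zero_le_one zero_le_one le_rfl, _,
    hmem le_rfl zero_le_one le_rfl zero_le_one, by simp only; module⟩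
  have hab : p (a + b) ≤ 2 := (h.le_two_iff _).2 ⟨_, hmem zero_le_one le_rfl zero_le_one le_rfl, _,
    hmem le_rfl zero_le_one le_rfl zero_le_one, by simp only; module⟩
  have hab' : p (a - b) ≤ 2 := (h.le_two_iff _).2 ⟨_, hmem zero_le_one le_rfl le_rfl zero_le_one, _,
    hmem le_rfl zero_le_one zero_le_one le_rfl, by simp only; module⟩
  have ha' : 2 ≤ p a := by
    by_contra! hlt
    -- For `q = p a < 2` the factor `2 - q / 2` exceeds `1`, while `(2 - q / 2) * q = 2 - (q - 2) ^
    -- 2 / 2 ≤ 2`.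
    have := (hbound (2 - p a / 2) 0 (by
      rw [zero_smul, add_zero, map_smul_nonneg (by linarith)]; nlinarith [sq_nonneg (p a - 2)])).1
    linarith
  have hb' : 2 ≤ p b := by
    by_contra! hlt
    have := (hbound 0 (2 - p b / 2) (by
      rw [zero_smul, zero_add, map_smul_nonneg (by linarith)]; nlinarith [sq_nonneg (p b - 2)])).2
    linarith
  refine ⟨(1 / 2 : ℝ) • a, (1 / 2 : ℝ) • b, ?_, ?_, ?_, ?_⟩
  · rw [map_smul_nonneg (by norm_num)]; linarith
  · rw [map_smul_nonneg (by norm_num)]; linarith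
  · rw [← smul_add, map_smul_nonneg (by norm_num)]; linarith
  · rw [← smul_sub, map_smul_nonneg (by norm_num)]; linarith

lemma IsNormOf.isParallelogram {C : Set Plane} (h : IsNormOf p C) (hC : Convex ℝ C) {a b : Plane}
    (hs : IsSquare p a b) : IsParallelogram C := by
  have hc0 := hs.cross_ne_zero
  have hli : ∀ s t : ℝ, s • a + t • b = 0 → s = 0 ∧ t = 0 := by
    intro s t hst
    have h1 := congrArg (cross a) hst
    have h2 := congrArg (fun x => cross x b) hst
    simp only [cross_add_left, cross_add_right, cross_smul_left, cross_smul_right, cross_self,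
      cross_zero_left, cross_zero_right, mul_zero, zero_add, add_zero] at h1 h2
    exact ⟨(mul_eq_zero.1 h2).resolve_right hc0, (mul_eq_zero.1 h1).resolve_right hc0⟩
  have hcorner : ∀ t : ℝ, |t| = 1 → ∃ x ∈ C, ∃ y ∈ C, x - y = (2 : ℝ) • a + (2 * t) • b := by
    intro t ht
    refine (h.le_two_iff _).1 ?_
    rw [hs.map_eq, abs_mul, ht]; simp
  -- The corners `2a ± 2b` of `C - C` are differences of points of `C`. Distances from `q` and `x`
  -- confine `C` to the parallelogram with these opposite vertices; the other difference then forces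
  -- `y` and `w` to be the remaining vertices, and convexity fills it.
  obtain ⟨x, hx, q, hq, hxq⟩ := hcorner 1 (by simp)
  obtain ⟨y, hy, w, hw, hyw⟩ := hcorner (-1) (by simp)
  have hcoord : ∀ c ∈ C, ∃ s t : ℝ, c = q + s • a + t • b ∧ 0 ≤ s ∧ s ≤ 2 ∧ 0 ≤ t ∧ t ≤ 2 := by
    intro c hc
    obtain ⟨s, t, hst⟩ := exists_coords hc0 (c - q)
    have h1 := (h.le_two_iff _).2 ⟨c, hc, q, hq, rfl⟩
    have h2 := (h.le_two_iff _).2 ⟨c, hc, x, hx, rfl⟩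
    have e2 : c - x = (s - 2) • a + (t - 2) • b := by
      have : c - x = c - q - (x - q) := by abel
      rw [this, hst, hxq]; module
    simp only [hst, e2, hs.map_eq, max_le_iff, abs_le] at h1 h2
    refine ⟨s, t, ?_, by linarith [h2.1.1], by linarith [h1.1.2], by linarith [h2.2.1],
      by linarith [h1.2.2]⟩
    rw [add_assoc, ← hst]; abel
  obtain ⟨s, t, hyst, hs0, hs2, ht0, ht2⟩ := hcoord y hy
  obtain ⟨s', t', hwst, hs0', hs2', ht0', ht2'⟩ := hcoord w hw
  obtain ⟨k1, k2⟩ := hli (s - s' - 2) (t - t' + 2) (by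
    have : (s - s' - 2) • a + (t - t' + 2) • b = y - w - ((2 : ℝ) • a + (2 * -1 : ℝ) • b) := by
      rw [hyst, hwst]; module
    rw [this, hyw, sub_self])
  have hy' : y = q + (2 : ℝ) • a := by
    rw [hyst, show s = 2 by linarith, show t = 0 by linarith]; module
  have hw' : w = q + (2 : ℝ) • b := by
    rw [hwst, show s' = 0 by linarith, show t' = 2 by linarith]; module
  have hx' : x = q + (2 : ℝ) • a + (2 : ℝ) • b := by
    have : x = x - q + q := by abel
    rw [this, hxq]; module
  refine ⟨q, (2 : ℝ) • a, (2 : ℝ) • b, ?_, ?_⟩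
  · rw [LinearIndependent.pair_iff]
    intro s t hst
    have := hli (s * 2) (t * 2) (by rw [← hst]; module)
    exact ⟨by linarith [this.1], by linarith [this.2]⟩
  · ext c
    constructor
    · intro hc
      obtain ⟨s, t, rfl, h1, h2, h3, h4⟩ := hcoord c hc
      exact ⟨s / 2, ⟨by linarith, by linarith⟩, t / 2, ⟨by linarith, by linarith⟩, by module⟩
    · rintro ⟨s, hs, t, ht, rfl⟩
      have l1 := hC hq hy (sub_nonneg.2 hs.2) hs.1 (by ring)
      have l2 := hC hw hx (sub_nonneg.2 hs.2) hs.1 (by ring)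
      have l3 := hC l1 l2 (sub_nonneg.2 ht.2) ht.1 (by ring)
      convert l3 using 1
      rw [hy', hw', hx']; module

end DualHadwiger

open DualHadwiger in
theorem mainTheorem6 (C : Set Plane) (hC : IsConvexDisc C) :
    (¬ IsParallelogram C → IsDualHadwigerNumber C 6 ∧ IsDualStrictHadwigerNumber C 7) ∧
    (IsParallelogram C → IsDualHadwigerNumber C 4 ∧ IsDualStrictHadwigerNumber C 8) ∧
    (∀ n : ℕ, IsDualHadwigerNumber C n ↔ IsMinSize (IsUnitCircuit C) n) ∧
    (∀ n : ℕ, IsDualStrictHadwigerNumber C n ↔ IsMinSize (IsStrictUnitCircuit C) n) := by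
  obtain ⟨p, hp⟩ := hC.exists_isNormOf
  refine ⟨fun hpar => ?_, fun hpar => ?_, fun n => ?_, fun n => ?_⟩
  · have hsq : ∀ u v, ¬ IsSquare p u v := fun u v h => hpar (hp.isParallelogram hC.convex h)
    exact ⟨(hp.isMinSize_dualFamily 6).2 (isMinSize_of_bounds (fun V hV => hV.six_le_card hsq)
      (exists_circuit_six hp.isPlaneNorm)), (hp.isMinSize_dualStrictFamily 7).2
      (isMinSize_of_bounds (fun V hV => hV.seven_le_card)
        (exists_strictCircuit_seven hp.isPlaneNorm hsq))⟩
  · obtain ⟨a, b, hs⟩ := hp.exists_isSquare hpar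
    exact ⟨(hp.isMinSize_dualFamily 4).2 (isMinSize_of_bounds (fun V hV => hV.four_le_card)
      hs.exists_circuit_four), (hp.isMinSize_dualStrictFamily 8).2
      (isMinSize_of_bounds (fun V hV => hV.eight_le_card hs) hs.exists_strictCircuit_eight)⟩
  · have : IsUnitCircuit C = IsCircuit p := funext fun V => propext (hp.isUnitCircuit_iff V)
    rw [this]; exact hp.isMinSize_dualFamily n
  · have : IsStrictUnitCircuit C = IsStrictCircuit p :=
      funext fun V => propext (hp.isStrictUnitCircuit_iff V)
    rw [this]; exact hp.isMinSize_dualStrictFamily n
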